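/- **Theorem (upper bound for ULCB).** *Model.* Let $M\ge 2$, let $a_1,\dots,a_M$ be arms with mean rewards $\mu(a_i)\in[0,1]$, and let $q(s,r)\in[0,1]$ for $s,r\in\{0,1\}$. Episodes $k=1,2,\dots$ are played one after the other. The initial state $S_{k,1}\in\{0,1\}$ of episode $k$ is drawn, independently of the past, from an arbitrary distribution (which may depend on $k$). At step $h$ of episode $k$ a policy $\pi$ chooses an arm $A_{k,h}$ as a deterministic function of the state $S_{k,h}$ and of the history (all earlier steps, with their division into episodes); given these, the reward $R_{k,h}\in\{0,1\}$ is Bernoulli with mean $\mu(A_{k,h})$, and then the user abandons with probability $q(S_{k,h},R_{k,h})$. Abandonment ends the episode; otherwise $S_{k,h+1}=R_{k,h}$. Let $V^*(s)$ be the expected total reward in one episode that starts in state $s$ when $a_1$ is always pulled, and let $Q^*(s,a)$ be $\mu(a)$ plus the expected total reward from the second step on in one episode that starts in state $s$ when $a$ is pulled first and $a_1$ at all later steps. The expected regret $\mathbb E[\mathrm{Reg}_\pi(K)]$ is the expected total reward over the first $K$ episodes when $a_1$ is always pulled, minus the expected total reward over the first $K$ episodes under $\pi$. *Algorithm.* Let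 $t=1,2,\dots$ count the steps over all episodes, let $N_t(a)$ be the number of pulls of arm $a$ before time $t$ and $\bar\mu_t(a)$ the average reward of these pulls. ULCB with constants $c_0,c_1,c$ is any policy that pulls an arm with $N_t(a)=0$ as long as there is one, and afterwards, when the current state is $s$, pulls an arm maximizing $$\bar\mu_t(a)+c_s\sqrt{\frac{\log t+c\log(\log t)}{2N_t(a)}}$$ (the order of the first pulls and the tie-breaking are arbitrary). *Claim.* Assume that $q(i,j)\ge q(i',j')$ whenever $i+j<i'+j'$, that $q(0,0)>0$, that $0<\mu(a_M)\le\dots\le\mu(a_2)<\mu(a_1)<1$, that $q(0,1)<1$ and $q(1,1)<1$, and that $V^*(0)-Q^*(0,a)\ge V^*(1)-Q^*(1,a)$ for every $a\ne a_1$. Then under ULCB with $c_0=-1$, $c_1=1$, $c=4$, all the expectations above are finite and $$\limsup_{K\to\infty}\frac{\mathbb E[\mathrm{Reg}_\pi(K)]}{\log K}\le\sum_{i\ne1}\frac{V^*(1)-Q^*(1,a_i)}{2(\mu(a_1)-\mu(a_i))^2}.$$ -/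

import Mathlib

open MeasureTheory ProbabilityTheory Filter
open scoped ENNReal

namespace MABA

/-- A bandit with abandonment and `M` arms: pulling arm `a` gives a Bernoulli reward with mean
`mean a`; if the current state is `s` and the reward is `r`, then the user leaves with probability
`quit s r`. States and rewards are Booleans: `false` stands for `0` and `true` for `1`. -/
structure Model (M : ℕ) where
  mean : Fin M → unitInterval
  quit : Bool → Bool → unitInterval

/-- One time step: the state, the arm pulled, the reward obtained, and whether the user left right
after it (so that the current episode ended and the next step starts a new one). -/
structure Step (M : ℕ) where
  state : Bool
  arm : Fin M
  reward : Bool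
  left : Bool
  deriving DecidableEq, Fintype

instance (M : ℕ) : MeasurableSpace (Step M) := ⊤

instance (M : ℕ) : DiscreteMeasurableSpace (Step M) := ⟨fun _ => trivial⟩

/-- A deterministic policy selects an arm from the current (non-terminal) state and the history,
that is, the chronological list of all earlier steps, those of earlier episodes included. The
flags `left` show how the list splits into episodes. -/
abbrev Policy (M : ℕ) := Bool → List (Step M) → Fin M

/-- The policy that always pulls arm `b`. -/
def always {M : ℕ} (b : Fin M) : Policy M := fun _ _ => b

/-- The policy that pulls arm `a` at the very first step and arm `b` ever after. -/
def firstThen {M : ℕ} (a b : Fin M) : Policy M := fun _ h => if h = [] then a else b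

section Dynamics

variable {M : ℕ}

/-- The Bernoulli distribution on `{false, true}` with parameter `p`. -/
noncomputable def bern (p : unitInterval) : PMF Bool := (bernoulliMeasure true false p).toPMF

/-- The number of episodes completed in a history. -/
def completed (h : List (Step M)) : ℕ := h.countP fun x => x.left

/-- The distribution of the current state given the history: at the beginning of an episode an
initial state is drawn (it is `1` with probability `init k` if `k` episodes were completed before),
and within an episode the state is the previous reward. -/
noncomputable def stateDist (init : ℕ → unitInterval) (h : List (Step M)) : PMF Bool :=
  match h.getLast? with
  | none => bern (init 0)
  | some x => if x.left then bern (init (completed h)) else PMF.pure x.reward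

/-- The distribution of the next step given the history, under the policy `π`. -/
noncomputable def stepDist (P : Model M) (init : ℕ → unitInterval) (π : Policy M)
    (h : List (Step M)) : PMF (Step M) :=
  (stateDist init h).bind fun s =>
    (bern (P.mean (π s h))).bind fun r =>
      (bern (P.quit s r)).bind fun d => PMF.pure ⟨s, π s h, r, d⟩

/-- The steps at the times `0, …, n` as a list. -/
def toHistory (n : ℕ) (x : Finset.Iic n → Step M) : List (Step M) :=
  List.ofFn fun i : Fin (n + 1) => x ⟨i, Finset.mem_Iic.2 (Nat.lt_succ_iff.1 i.2)⟩

/-- The transition kernel from the first `n + 1` steps to the next one. -/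
noncomputable def stepKernel (P : Model M) (init : ℕ → unitInterval) (π : Policy M) (n : ℕ) :
    Kernel (Finset.Iic n → Step M) (Step M) :=
  Kernel.ofFunOfCountable fun x => (stepDist P init π (toHistory n x)).toMeasure

instance (P : Model M) (init : ℕ → unitInterval) (π : Policy M) (n : ℕ) :
    IsMarkovKernel (stepKernel P init π n) :=
  ⟨fun x => inferInstanceAs
    (IsProbabilityMeasure (stepDist P init π (toHistory n x)).toMeasure)⟩

/-- The law of the infinite sequence of steps (over all episodes, one after the other) generated by
the policy `π`. -/
noncomputable def law (P : Model M) (init : ℕ → unitInterval) (π : Policy M) :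
    Measure (ℕ → Step M) :=
  Kernel.trajMeasure (X := fun _ => Step M) (stepDist P init π []).toMeasure
    (stepKernel P init π)

/-- The number of the episode (counted from `0`) to which time `t` (counted from `0`) belongs. -/
def episode (x : ℕ → Step M) (t : ℕ) : ℕ := ((Finset.range t).filter fun s => (x s).left).card

/-- The reward at time `t`, counted only if `t` belongs to one of the first `K` episodes. -/
def rewardAt (K : ℕ) (x : ℕ → Step M) (t : ℕ) : ℝ≥0∞ :=
  if episode x t < K ∧ (x t).reward = true then 1 else 0

/-- The expected total reward collected under `π` in the first `K` episodes. -/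
noncomputable def expReward (P : Model M) (init : ℕ → unitInterval) (π : Policy M) (K : ℕ) :
    ℝ≥0∞ :=
  ∫⁻ x, ∑' t, rewardAt K x t ∂(law P init π)

/-- All episodes start in state `s`. -/
def startAt (s : Bool) : ℕ → unitInterval := fun _ => if s then 1 else 0

/-- `V*(s)`, where `b` is the best arm: the expected total reward in one episode that starts in
state `s`, if arm `b` is always pulled. -/
noncomputable def valueV (P : Model M) (b : Fin M) (s : Bool) : ℝ≥0∞ :=
  expReward P (startAt s) (always b) 1

/-- `Q*(s, a)`, where `b` is the best arm: `μ(a)` plus the expected total reward in one episode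
that starts in state `s`, from the second step on, if arm `a` is pulled first and arm `b` from
then on. -/
noncomputable def valueQ (P : Model M) (b : Fin M) (s : Bool) (a : Fin M) : ℝ≥0∞ :=
  ENNReal.ofReal (P.mean a) +
    ∫⁻ x, ∑' t, rewardAt 1 x (t + 1) ∂(law P (startAt s) (firstThen a b))

/-- The gap `V*(s) - Q*(s, a)`. -/
noncomputable def gap (P : Model M) (b : Fin M) (s : Bool) (a : Fin M) : ℝ :=
  (valueV P b s).toReal - (valueQ P b s a).toReal

/-- The expected regret of `π` over `K` episodes, relative to always pulling the best arm `b`. -/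
noncomputable def regret (P : Model M) (init : ℕ → unitInterval) (b : Fin M) (π : Policy M)
    (K : ℕ) : ℝ :=
  (expReward P init (always b) K).toReal - (expReward P init π K).toReal

end Dynamics

section Algorithm

variable {M : ℕ}

/-- `N_t(a)`: how often arm `a` was pulled in the history. -/
def pulls (h : List (Step M)) (a : Fin M) : ℕ := h.countP fun x => x.arm = a

/-- The average of the rewards obtained from arm `a` in the history. -/
noncomputable def empMean (h : List (Step M)) (a : Fin M) : ℝ :=
  (h.countP fun x => x.arm = a ∧ x.reward = true : ℕ) / (pulls h a : ℝ)

/-- The index `μ̄_t(a) + C √((log t + c log log t) / (2 N_t(a)))` at time `t`, where time is counted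
from `1`. -/
noncomputable def index (c C : ℝ) (h : List (Step M)) (a : Fin M) : ℝ :=
  empMean h a + C * √((Real.log (h.length + 1 : ℕ) +
    c * Real.log (Real.log (h.length + 1 : ℕ))) / (2 * pulls h a))

/-- `π` implements the ULCB algorithm with the constants `c₀`, `c₁`, `c`: as long as some arm was
never pulled, such an arm is pulled; afterwards an arm of maximal index is pulled, where the
coefficient of the exploration term is `c₀` in state `0` and `c₁` in state `1`. The order of the
first pulls and the way in which ties are broken are left open. -/
def IsULCB (c₀ c₁ c : ℝ) (π : Policy M) : Prop :=
  ∀ (s : Bool) (h : List (Step M)),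
    ((∃ a, pulls h a = 0) → pulls h (π s h) = 0) ∧
    ((∀ a, pulls h a ≠ 0) →
      ∀ a, index c (if s then c₁ else c₀) h a ≤ index c (if s then c₁ else c₀) h (π s h))

end Algorithm

end MABA

/-! Regret as accumulated loss. For the best arm `b`, the Bellman equations of "always pull `b`" are
a 2×2 linear system with positive determinant, solved explicitly by `optV`. Under any policy, the
rewards so far, plus the losses `optV - optQ` so far, plus the value still to be earned with `b`,
form a martingale (`stepExp_remaining`). Episodes are completed at a linear rate up to exponentially
small probabilities, so the value still to be earned tends to zero and the regret is the expected
total loss in the first `K` episodes (`regret_eq`). Up to a bounded error only the first `N * K`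
steps matter, for a fixed `N`. Since all losses are nonnegative, it remains to count the pulls of
each suboptimal arm `a` in each state.

State 1 is the usual UCB argument (`exists_sum_law_true_le`): once `a` has about `level n / (2 * Δ ^
2)` pulls, where `Δ` is its mean gap, a further optimistic pull needs a deviation of an empirical
mean. An exponential supermartingale gives Hoeffding bounds for the first `s` rewards of an arm,
whatever the random times of its pulls. Overestimates of `a` are summed over the pull counter,
underestimates of `b` over time, with the summable weights `exp (-level t)`. Both sums stay bounded.

In state 0 the index is a lower confidence bound, and the number of suboptimal pulls is bounded
(`exists_sum_law_false_le`): if `b` has linearly many pulls, its lower bound is close to its mean,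
so a suboptimal arm wins only through a deviation. That `b` has linearly many pulls
(`exists_summable_pulls_lt`) comes from state 1, which occurs linearly often. By pigeonhole some arm
is pulled linearly often there, and optimism excludes every arm other than `b`.

Dividing by `log K` removes the bounded terms and the factor `N`. Letting the slack `ε` tend to zero
gives the constant. -/

namespace MABA

/-! ### Finite expectations and the one-step dynamics of the trajectory law -/

/-- Expectation of `g` under the Bernoulli distribution with parameter `p`. -/
def bernExp (p : unitInterval) (g : Bool → ℝ) : ℝ := p * g true + (1 - p) * g false

lemma bernExp_mono {p : unitInterval} {g g' : Bool → ℝ} (h : ∀ b, g b ≤ g' b) :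
    bernExp p g ≤ bernExp p g' :=
  add_le_add (mul_le_mul_of_nonneg_left (h _) p.2.1)
    (mul_le_mul_of_nonneg_left (h _) (sub_nonneg.2 p.2.2))

lemma bernExp_const (p : unitInterval) (c : ℝ) : bernExp p (fun _ => c) = c := by
  simp only [bernExp]; ring

/-- Expectation of `g` under the distribution of the state that follows the history `h`. -/
def stateExp {M : ℕ} (init : ℕ → unitInterval) (h : List (Step M)) (g : Bool → ℝ) : ℝ :=
  match h.getLast? with
  | none => bernExp (init 0) g
  | some x => if x.left then bernExp (init (completed h)) g else g x.reward

/-- Expectation of `g` under the distribution of the step that follows the history `h`. -/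
def stepExp {M : ℕ} (P : Model M) (init : ℕ → unitInterval) (π : Policy M)
    (h : List (Step M)) (g : Step M → ℝ) : ℝ :=
  stateExp init h fun s => bernExp (P.mean (π s h)) fun r =>
    bernExp (P.quit s r) fun d => g ⟨s, π s h, r, d⟩

section
variable {M : ℕ} (P : Model M) (init : ℕ → unitInterval) (π : Policy M)

lemma stateExp_mono {h : List (Step M)} {g g' : Bool → ℝ} (hg : ∀ b, g b ≤ g' b) :
    stateExp init h g ≤ stateExp init h g' := by
  unfold stateExp
  split
  · exact bernExp_mono hg
  · split_ifs
    · exact bernExp_mono hg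
    · exact hg _

lemma stateExp_const (h : List (Step M)) (c : ℝ) : stateExp init h (fun _ => c) = c := by
  unfold stateExp
  split
  · exact bernExp_const _ _
  · split_ifs
    · exact bernExp_const _ _
    · rfl

lemma sum_bern (p : unitInterval) (g : Bool → ℝ) :
    ∑ b, (bern p b).toReal * g b = bernExp p g := by
  classical
  have h : ∀ b, (bern p b).toReal = if b then (p : ℝ) else 1 - p := by
    intro b
    rw [bern, Measure.toPMF_apply, bernoulliMeasure_apply _ (MeasurableSet.singleton b)]
    cases b <;> simp
  simp [h, bernExp]

lemma sum_bind {α β : Type*} [Fintype α] [Fintype β] (p : PMF α) (f : α → PMF β) (g : β → ℝ) :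
    ∑ b, (p.bind f b).toReal * g b = ∑ a, (p a).toReal * ∑ b, (f a b).toReal * g b := by
  have h : ∀ b, (p.bind f b).toReal = ∑ a, (p a).toReal * (f a b).toReal := by
    intro b
    rw [PMF.bind_apply, tsum_fintype, ENNReal.toReal_sum]
    · simp
    · intro a _
      exact ENNReal.mul_ne_top (p.apply_ne_top a) ((f a).apply_ne_top b)
  simp only [h, Finset.sum_mul, Finset.mul_sum]
  rw [Finset.sum_comm]
  simp only [mul_assoc]

lemma sum_pure {β : Type*} [Fintype β] (z : β) (g : β → ℝ) :
    ∑ b, (PMF.pure z b).toReal * g b = g z := by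
  classical
  rw [Finset.sum_eq_single z]
  · simp
  · intro b _ hb
    simp [PMF.pure_apply, hb]
  · simp

lemma sum_stateDist (h : List (Step M)) (g : Bool → ℝ) :
    ∑ s, (stateDist init h s).toReal * g s = stateExp init h g := by
  unfold stateDist stateExp
  rcases h.getLast? with _ | x
  · exact sum_bern _ _
  · dsimp only
    split_ifs
    · exact sum_bern _ _
    · exact sum_pure _ _

lemma integral_stepDist (h : List (Step M)) (g : Step M → ℝ) :
    ∫ y, g y ∂(stepDist P init π h).toMeasure = stepExp P init π h g := by
  rw [PMF.integral_eq_sum]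
  simp only [smul_eq_mul, stepDist, sum_bind, sum_pure, sum_bern, sum_stateDist, stepExp]

/-- The list of the first `n` steps. -/
def hist (n : ℕ) (x : ℕ → Step M) : List (Step M) := List.ofFn fun i : Fin n => x i

@[simp] lemma hist_zero (x : ℕ → Step M) : hist 0 x = [] := rfl

lemma hist_succ (n : ℕ) (x : ℕ → Step M) : hist (n + 1) x = hist n x ++ [x n] := by
  rw [hist, List.ofFn_succ_last]; rfl

@[simp] lemma length_hist (n : ℕ) (x : ℕ → Step M) : (hist n x).length = n := by
  simp [hist]

lemma hist_prefix {m n : ℕ} (h : m ≤ n) (x : ℕ → Step M) : hist m x <+: hist n x := by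
  induction n, h using Nat.le_induction with
  | base => exact List.prefix_rfl
  | succ n _ ih => exact ih.trans (by rw [hist_succ]; exact List.prefix_append _ _)

instance : IsProbabilityMeasure (law P init π) := by
  unfold law; infer_instance

lemma measurable_hist {β : Type*} [MeasurableSpace β] (n : ℕ) (F : List (Step M) → β) :
    Measurable fun x : ℕ → Step M => F (hist n x) := by
  have h : Measurable fun z : Fin n → Step M => F (List.ofFn z) := Measurable.of_discrete
  exact h.comp (measurable_pi_lambda _ fun i => measurable_pi_apply _)

lemma integrable_hist (n : ℕ) (F : List (Step M) → ℝ) :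
    Integrable (fun x => F (hist n x)) (law P init π) := by
  obtain ⟨C, hC⟩ : ∃ C : ℝ, ∀ z : Fin n → Step M, |F (List.ofFn z)| ≤ C := by
    obtain ⟨C, hC⟩ := (Set.finite_range fun z : Fin n → Step M => |F (List.ofFn z)|).bddAbove
    exact ⟨C, fun z => hC ⟨z, rfl⟩⟩
  exact Integrable.of_bound (measurable_hist n F).aestronglyMeasurable C
    (Eventually.of_forall fun x => hC _)

lemma law_map_zero : (law P init π).map (fun x => x 0) = (stepDist P init π []).toMeasure := by
  have h1 : (fun x : ℕ → Step M => x 0) =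
      (fun z : Finset.Iic 0 → Step M => z ⟨0, by simp⟩) ∘ Preorder.frestrictLe 0 := rfl
  rw [h1, ← Measure.map_map (by fun_prop) (by fun_prop), law, Kernel.trajMeasure,
    Measure.map_comp _ _ (by fun_prop), Kernel.traj_map_frestrictLe, Kernel.partialTraj_self,
    Measure.id_comp, Measure.map_map (by fun_prop) (by fun_prop)]
  convert Measure.map_id
  funext y
  rfl

/-- One step of the dynamics. -/
lemma integral_step (n : ℕ) (G : List (Step M) → Step M → ℝ) :
    ∫ x, G (hist n x) (x n) ∂(law P init π) =
      ∫ x, stepExp P init π (hist n x) (G (hist n x)) ∂(law P init π) := by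
  cases n with
  | zero =>
    simp only [hist_zero, integral_const, probReal_univ, one_smul]
    rw [← integral_stepDist, ← law_map_zero,
      integral_map (measurable_pi_apply 0).aemeasurable
        (Measurable.of_discrete.aestronglyMeasurable)]
  | succ n =>
    have hm : Measurable fun p : (Finset.Iic n → Step M) × Step M =>
        G (toHistory n p.1) p.2 := Measurable.of_discrete
    have h1 : ∫ x, G (hist (n + 1) x) (x (n + 1)) ∂(law P init π) =
        ∫ p, G (toHistory n p.1) p.2 ∂((law P init π).map
          (fun x => (Preorder.frestrictLe (π := fun _ => Step M) n x, x (n + 1)))) := by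
      rw [integral_map (by fun_prop) hm.aestronglyMeasurable]
      rfl
    have h2 : (law P init π).map
          (fun x => (Preorder.frestrictLe (π := fun _ => Step M) n x, x (n + 1))) =
        (law P init π).map (Preorder.frestrictLe (π := fun _ => Step M) n) ⊗ₘ
          stepKernel P init π n :=
      (Kernel.map_frestrictLe_trajMeasure_compProd_eq_map_trajMeasure
        (X := fun _ => Step M)).symm
    have : IsProbabilityMeasure
        ((law P init π).map (Preorder.frestrictLe (π := fun _ => Step M) n)) :=
      Measure.isProbabilityMeasure_map (by fun_prop)
    have hi : Integrable (fun p : (Finset.Iic n → Step M) × Step M => G (toHistory n p.1) p.2)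
        ((law P init π).map (Preorder.frestrictLe (π := fun _ => Step M) n) ⊗ₘ
          stepKernel P init π n) := by
      exact Integrable.of_finite
    rw [h1, h2, Measure.integral_compProd hi,
      integral_map (by fun_prop) (Measurable.of_discrete.aestronglyMeasurable)]
    refine integral_congr_ae (Eventually.of_forall fun x => ?_)
    exact integral_stepDist P init π (hist (n + 1) x) _

lemma integral_hist_succ (n : ℕ) (F : List (Step M) → ℝ) :
    ∫ x, F (hist (n + 1) x) ∂(law P init π) =
      ∫ x, stepExp P init π (hist n x) (fun y => F (hist n x ++ [y])) ∂(law P init π) := by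
  simp only [hist_succ]
  exact integral_step P init π n fun h y => F (h ++ [y])

/-- Expectations decay geometrically if they do so in each step. -/
lemma integral_hist_le_pow {ρ : ℝ} (hρ : 0 ≤ ρ) (F : List (Step M) → ℝ)
    (hF : ∀ h, stepExp P init π h (fun y => F (h ++ [y])) ≤ ρ * F h) (n : ℕ) :
    ∫ x, F (hist n x) ∂(law P init π) ≤ ρ ^ n * F [] := by
  induction n with
  | zero => simp
  | succ n ih =>
    rw [integral_hist_succ]
    have h1 := integral_mono (μ := law P init π)
      (integrable_hist P init π n fun h => stepExp P init π h fun y => F (h ++ [y]))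
      (integrable_hist P init π n fun h => ρ * F h) fun x => hF (hist n x)
    refine h1.trans ?_
    rw [integral_const_mul, pow_succ', mul_assoc]
    exact mul_le_mul_of_nonneg_left ih hρ

/-- Markov's inequality. The set `A` is arbitrary, so it may describe something that happened at any
time up to `n`. -/
lemma law_real_hist_le {n : ℕ} (F : List (Step M) → ℝ) (hF : ∀ h, 0 ≤ F h) {c : ℝ} (hc : 0 < c)
    (A : Set (ℕ → Step M)) (hA : ∀ x ∈ A, c ≤ F (hist n x)) :
    (law P init π).real A ≤ c⁻¹ * ∫ x, F (hist n x) ∂(law P init π) := by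
  have h := mul_meas_ge_le_integral_of_nonneg (μ := law P init π)
    (Eventually.of_forall fun x => hF (hist n x)) (integrable_hist P init π n F) c
  rw [le_inv_mul_iff₀ hc]
  exact (mul_le_mul_of_nonneg_left (measureReal_mono hA) hc.le).trans h

/-- The arm pulled is the one that the policy selects. -/
lemma ae_arm : ∀ᵐ x ∂(law P init π), ∀ n, (x n).arm = π (x n).state (hist n x) := by
  rw [ae_all_iff]
  intro n
  classical
  -- The indicator of a violation at time `n` has expectation zero.
  have h := integral_step P init π n fun h y => if y.arm = π y.state h then 0 else 1
  have h0 : ∀ h, stepExp P init π h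
      (fun y => if y.arm = π y.state h then (0 : ℝ) else 1) = 0 := by
    intro h
    simp only [stepExp, if_true]
    simp [bernExp_const, stateExp_const]
  simp only [h0, integral_zero] at h
  rw [integral_eq_zero_iff_of_nonneg] at h
  · filter_upwards [h] with x hx
    by_contra hne
    simp [hne] at hx
  · intro x
    dsimp only
    split_ifs <;> simp
  · have := integrable_hist P init π (n + 1) fun h =>
      match h.getLast? with
      | none => 0
      | some y => if y.arm = π y.state h.dropLast then (0 : ℝ) else 1
    simpa [hist_succ] using this

lemma episode_eq (x : ℕ → Step M) (t : ℕ) : episode x t = completed (hist t x) := by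
  induction t with
  | zero => simp [episode, completed]
  | succ t ih =>
    rw [hist_succ]
    simp only [completed, List.countP_append] at ih ⊢
    rw [← ih, episode, episode, Finset.range_add_one, Finset.filter_insert]
    split_ifs with h
    · rw [Finset.card_insert_of_notMem (by simp)]
      simp [h]
    · simp [h]

end

/-! ### Bellman equations and the value still to be earned -/

section
variable {M : ℕ} (P : Model M) (init : ℕ → unitInterval) (π : Policy M) (b : Fin M)

/-- The determinant of the Bellman system for the policy that always pulls `b`. -/
noncomputable def bellmanDet : ℝ :=
  (1 - P.mean b * (1 - P.quit true true)) * (1 - (1 - P.mean b) * (1 - P.quit false false)) -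
    P.mean b * (1 - P.mean b) * (1 - P.quit false true) * (1 - P.quit true false)

/-- The solution of the Bellman system for the policy that always pulls `b`. -/
noncomputable def optV (s : Bool) : ℝ :=
  if s then P.mean b * ((1 - (1 - P.mean b) * (1 - P.quit false false)) +
    (1 - P.mean b) * (1 - P.quit true false)) / bellmanDet P b
  else P.mean b * (P.mean b * (1 - P.quit false true) +
    (1 - P.mean b * (1 - P.quit true true))) / bellmanDet P b

/-- The action value that belongs to `optV`. -/
noncomputable def optQ (s : Bool) (a : Fin M) : ℝ :=
  bernExp (P.mean a) fun r => (if r then 1 else 0) + (1 - P.quit s r) * optV P b r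

/-- The loss of pulling `a` in state `s`. -/
noncomputable def loss (s : Bool) (a : Fin M) : ℝ := optV P b s - optQ P b s a

variable {P b}

/-- With `μ = P.mean b`, the determinant is at least `(1 - μ) * (μ + (1 - μ) * q(0,0)) - μ * (1 - μ)
= (1 - μ) ^ 2 * q(0,0)`. -/
lemma bellmanDet_pos (hb : P.mean b < 1) (hq : 0 < P.quit false false) : 0 < bellmanDet P b := by
  have hb' : (P.mean b : ℝ) < 1 := hb
  have hq' : (0 : ℝ) < P.quit false false := hq
  have h1 : (1 - (P.mean b : ℝ)) ≤ 1 - P.mean b * (1 - P.quit true true) := by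
    nlinarith [(P.mean b).2.1, (P.quit true true).2.1]
  have h2 : (P.mean b : ℝ) * (1 - P.mean b) * (1 - P.quit false true) * (1 - P.quit true false)
      ≤ P.mean b * (1 - P.mean b) := by
    have h0 : 0 ≤ (P.mean b : ℝ) * (1 - P.mean b) :=
      mul_nonneg (P.mean b).2.1 (by linarith)
    have h3 : (1 - (P.quit false true : ℝ)) * (1 - P.quit true false) ≤ 1 :=
      mul_le_one₀ (by linarith [(P.quit false true).2.1])
        (by linarith [(P.quit true false).2.2]) (by linarith [(P.quit true false).2.1])
    rw [mul_assoc]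
    exact mul_le_of_le_one_right h0 h3
  have h4 : (P.mean b : ℝ) + (1 - P.mean b) * P.quit false false =
    1 - (1 - P.mean b) * (1 - P.quit false false) := by ring
  have h5 : 0 < (1 - (P.mean b : ℝ)) * P.quit false false := mul_pos (by linarith) hq'
  rw [bellmanDet, ← h4]
  have h6 := mul_le_mul_of_nonneg_right h1
    (add_nonneg (P.mean b).2.1 h5.le)
  nlinarith [mul_pos (sub_pos.2 hb') h5]

lemma optV_eq (hb : P.mean b < 1) (hq : 0 < P.quit false false) (s : Bool) :
    optV P b s = optQ P b s b := by
  have hd := (bellmanDet_pos hb hq).ne'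
  cases s <;> simp only [optQ, bernExp, optV, if_true, Bool.false_eq_true, if_false] <;>
    field_simp <;> rw [bellmanDet] <;> ring

lemma loss_self (hb : P.mean b < 1) (hq : 0 < P.quit false false) (s : Bool) :
    loss P b s b = 0 := by
  rw [loss, ← optV_eq hb hq, sub_self]

lemma optV_nonneg (hb : P.mean b < 1) (hq : 0 < P.quit false false) (s : Bool) :
    0 ≤ optV P b s := by
  have hd := (bellmanDet_pos hb hq).le
  have h0 := (P.mean b).2.1
  have h1 : 0 ≤ 1 - (P.mean b : ℝ) := sub_nonneg.2 (P.mean b).2.2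
  have hc : ∀ s r, 0 ≤ 1 - (P.quit s r : ℝ) := fun s r => sub_nonneg.2 (P.quit s r).2.2
  have hc1 : ∀ s r, 1 - (P.quit s r : ℝ) ≤ 1 := fun s r => by linarith [(P.quit s r).2.1]
  have h2 : (1 - P.mean b : ℝ) * (1 - P.quit false false) ≤ 1 :=
    mul_le_one₀ (by linarith) (hc _ _) (hc1 _ _)
  have h3 : (P.mean b : ℝ) * (1 - P.quit true true) ≤ 1 :=
    mul_le_one₀ (P.mean b).2.2 (hc _ _) (hc1 _ _)
  unfold optV
  split_ifs
  · exact div_nonneg (mul_nonneg h0 (add_nonneg (by linarith) (mul_nonneg h1 (hc _ _)))) hd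
  · exact div_nonneg (mul_nonneg h0 (add_nonneg (mul_nonneg h0 (hc _ _)) (by linarith))) hd

lemma bernExp_le {p : unitInterval} {g : Bool → ℝ} {c : ℝ} (h : ∀ b, g b ≤ c) :
    bernExp p g ≤ c :=
  (bernExp_mono h).trans_eq (bernExp_const p c)

lemma bernExp_mul_left (p : unitInterval) (c : ℝ) (g : Bool → ℝ) :
    bernExp p (fun s => c * g s) = c * bernExp p g := by
  simp only [bernExp]; ring

lemma stateExp_mul_left (h : List (Step M)) (c : ℝ) (g : Bool → ℝ) :
    stateExp init h (fun s => c * g s) = c * stateExp init h g := by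
  unfold stateExp
  rcases h.getLast? with _ | x
  · exact bernExp_mul_left _ _ _
  · dsimp only
    split_ifs
    · exact bernExp_mul_left _ _ _
    · rfl

lemma stateExp_add_const (h : List (Step M)) (c : ℝ) (g : Bool → ℝ) :
    stateExp init h (fun s => g s + c) = stateExp init h g + c := by
  unfold stateExp
  rcases h.getLast? with _ | x
  · simp only [bernExp]; ring
  · dsimp only
    split_ifs
    · simp only [bernExp]; ring
    · rfl

lemma completed_append (h : List (Step M)) (y : Step M) :
    completed (h ++ [y]) = completed h + if y.left then 1 else 0 := by
  simp [completed, List.countP_append]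

variable (P b)

/-- The value of episode `k`. -/
noncomputable def episodeValue (k : ℕ) : ℝ := bernExp (init k) (optV P b)

/-- The expected reward that remains in the first `K` episodes if `b` is always pulled after the
history `h`. -/
noncomputable def remaining (K : ℕ) (h : List (Step M)) : ℝ :=
  if completed h < K then
    stateExp init h (optV P b) + ∑ k ∈ Finset.Ico (completed h + 1) K, episodeValue P init b k
  else 0

lemma remaining_append {K : ℕ} {h : List (Step M)} (hK : completed h < K) (y : Step M) :
    remaining P init b K (h ++ [y]) = (if y.left then 0 else optV P b y.reward) +
      ∑ k ∈ Finset.Ico (completed h + 1) K, episodeValue P init b k := by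
  rw [remaining, completed_append]
  by_cases hy : y.left
  · simp only [hy, if_true]
    split_ifs with h1
    · rw [Finset.sum_eq_sum_Ico_succ_bot h1]
      simp [stateExp, hy, episodeValue, completed_append]
    · rw [Finset.Ico_eq_empty (by omega)]
      simp
  · simp [hy, hK, stateExp]

variable {P b}

/-- The Bellman equation as a martingale identity: playing `π` for one step uses up remaining value
equal to the expected reward plus the expected loss. At the end of an episode the next summand
`episodeValue` takes over. -/
lemma stepExp_remaining (K : ℕ) (h : List (Step M)) :
    stepExp P init π h (fun y => remaining P init b K (h ++ [y]) +
      if completed h < K then (if y.reward then 1 else 0) + loss P b y.state y.arm else 0) =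
    remaining P init b K h := by
  by_cases hK : completed h < K
  · simp only [remaining_append P init b hK, hK, if_true, stepExp]
    rw [remaining, if_pos hK, ← stateExp_add_const]
    congr 1
    funext s
    simp only [loss, optQ, bernExp, if_true, Bool.false_eq_true, if_false]
    ring
  · have h1 : ∀ y, remaining P init b K (h ++ [y]) = 0 := fun y => by
      rw [remaining, completed_append, if_neg (by omega)]
    simp only [h1, if_neg hK, add_zero, stepExp, bernExp_const, stateExp_const]
    rw [remaining, if_neg hK]

lemma remaining_nonneg (hb : P.mean b < 1) (hq : 0 < P.quit false false) (K : ℕ)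
    (h : List (Step M)) : 0 ≤ remaining P init b K h := by
  have hv := optV_nonneg hb hq
  have h1 : ∀ k, 0 ≤ episodeValue P init b k := fun k => by
    rw [← bernExp_const (init k) 0]
    exact bernExp_mono hv
  rw [remaining]
  split_ifs
  · refine add_nonneg ?_ (Finset.sum_nonneg fun k _ => h1 k)
    rw [← stateExp_const init h 0]
    exact stateExp_mono _ hv
  · exact le_rfl

lemma remaining_le (hb : P.mean b < 1) (hq : 0 < P.quit false false) (K : ℕ)
    (h : List (Step M)) : remaining P init b K h ≤
      if completed h < K then (1 + K) * (optV P b true + optV P b false) else 0 := by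
  have hv := optV_nonneg hb hq
  have hv2 : ∀ s, optV P b s ≤ optV P b true + optV P b false := fun s => by
    cases s <;> linarith [hv true, hv false]
  have h1 : ∀ k, episodeValue P init b k ≤ optV P b true + optV P b false := fun k =>
    bernExp_le hv2
  have h0 : 0 ≤ optV P b true + optV P b false := add_nonneg (hv _) (hv _)
  rw [remaining]
  split_ifs
  · rw [add_mul, one_mul]
    refine add_le_add ?_ ?_
    · rw [← stateExp_const init h (optV P b true + optV P b false)]
      exact stateExp_mono _ hv2
    · refine (Finset.sum_le_card_nsmul _ _ _ fun k _ => h1 k).trans ?_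
      rw [nsmul_eq_mul, Nat.card_Ico]
      exact mul_le_mul_of_nonneg_right (by exact_mod_cast Nat.sub_le _ _) h0
  · exact le_rfl

/-! ### Exponential tail of the number of completed episodes -/

/-- Weight of a state in the exponential bound on the number of completed episodes. -/
def stateWeight (δ : ℝ) (s : Bool) : ℝ := if s then 1 + δ else 1

/-- The number of completed episodes grows linearly, with exponentially small exceptional
probability. -/
lemma exists_completed_tail (hm : ∀ a, P.mean a ≤ P.mean b) (hb : P.mean b < 1)
    (hq : 0 < P.quit false false) :
    ∃ ρ : ℝ, 0 < ρ ∧ ρ < 1 ∧ ∀ (init : ℕ → unitInterval) (π : Policy M) (t K : ℕ),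
      (law P init π).real {x | completed (hist t x) < K} ≤ 2 * ρ ^ t * 4 ^ K := by
  have hb' : (P.mean b : ℝ) < 1 := hb
  have hq' : (0 : ℝ) < P.quit false false := hq
  have hq1 := (P.quit false false).2.2
  have hb0 := (P.mean b).2.1
  -- From state 1 abandonment may be impossible, so no decay in one step is available from counting
  -- episodes alone. The extra weight `δ` of state 1 creates it: a failure either ends the episode
  -- or leads to the lighter state 0. In state 0 a failure ends the episode with probability at
  -- least `q(0,0)`, and `δ` is small enough for this gain to outweigh a return to state 1.
  obtain ⟨δ, hδ⟩ : ∃ δ : ℝ, δ = (1 - P.mean b) * P.quit false false / 4 := ⟨_, rfl⟩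
  have hδ0 : 0 < δ := by rw [hδ]; exact div_pos (mul_pos (by linarith) hq') (by norm_num)
  have hδ1 : δ ≤ 1 / 4 := by
    have := mul_le_one₀ (show 1 - (P.mean b : ℝ) ≤ 1 by linarith) hq'.le hq1
    linarith
  obtain ⟨ρ, hρ⟩ : ∃ ρ : ℝ, ρ = 1 - (1 - P.mean b) * δ / 2 := ⟨_, rfl⟩
  have hρ1 : ρ < 1 := by nlinarith [mul_pos (sub_pos.2 hb') hδ0]
  have hρ0 : 0 < ρ := by nlinarith
  refine ⟨ρ, hρ0, hρ1, fun init π t K => ?_⟩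
  -- At the start of an episode the state is not yet drawn, so the larger weight is used.
  set F : List (Step M) → ℝ := fun h => (1 / 4) ^ completed h *
    match h.getLast? with
      | none => 1 + δ
      | some x => if x.left then 1 + δ else stateWeight δ x.reward with hF
  have hF0 : ∀ h, (1 / 4) ^ completed h ≤ F h := by
    intro h
    refine le_mul_of_one_le_right (by positivity) ?_
    rcases h.getLast? with _ | x
    · dsimp only; linarith
    · dsimp only [stateWeight]; split_ifs <;> linarith
  have hstep : ∀ h, stepExp P init π h (fun y => F (h ++ [y])) ≤ ρ * F h := by
    intro h
    have h1 : ∀ y : Step M, F (h ++ [y]) = (1 / 4) ^ completed h *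
        if y.left then 1 / 4 * (1 + δ) else stateWeight δ y.reward := by
      intro y
      simp only [hF, completed_append, List.getLast?_concat, pow_add]
      by_cases hy : y.left <;> simp [hy, mul_assoc]
    have h2 : stepExp P init π h (fun y => F (h ++ [y])) ≤
        stateExp init h fun s => ((1 / 4) ^ completed h * ρ) * stateWeight δ s := by
      refine stateExp_mono _ fun s => ?_
      simp only [h1, bernExp_mul_left, mul_assoc]
      refine mul_le_mul_of_nonneg_left ?_ (by positivity)
      have hμ : (P.mean (π s h) : ℝ) ≤ P.mean b := hm _
      have hμ0 := (P.mean (π s h)).2.1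
      have e1 : bernExp (P.quit s true)
          (fun d => if d then 1 / 4 * (1 + δ) else stateWeight δ true) ≤ 1 + δ := by
        refine bernExp_le fun d => ?_
        cases d <;> simp [stateWeight]
        linarith
      cases s
      · have e2 : bernExp (P.quit false false)
            (fun d => if d then 1 / 4 * (1 + δ) else stateWeight δ false) ≤
              1 - P.quit false false / 2 := by
          simp only [bernExp, stateWeight, if_true, Bool.false_eq_true, if_false]
          nlinarith
        calc _ ≤ bernExp (P.mean (π false h))
              (fun r => if r then 1 + δ else 1 - P.quit false false / 2) :=
              bernExp_mono fun r => by cases r; exacts [e2, e1]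
          _ ≤ _ := by
              simp only [bernExp, stateWeight, if_true, Bool.false_eq_true, if_false]
              nlinarith
      · have e2 : bernExp (P.quit true false)
            (fun d => if d then 1 / 4 * (1 + δ) else stateWeight δ false) ≤ 1 := by
          refine bernExp_le fun d => ?_
          cases d <;> simp [stateWeight]
          linarith
        calc _ ≤ bernExp (P.mean (π true h)) (fun r => if r then 1 + δ else 1) :=
              bernExp_mono fun r => by cases r; exacts [e2, e1]
          _ ≤ _ := by
              simp only [bernExp, stateWeight, if_true, Bool.false_eq_true, if_false]
              nlinarith [mul_nonneg (sub_nonneg.2 hb'.le) hδ0.le]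
    refine h2.trans ?_
    rw [stateExp_mul_left, mul_comm _ ρ, mul_assoc]
    refine mul_le_mul_of_nonneg_left (mul_le_mul_of_nonneg_left ?_ (by positivity)) hρ0.le
    have h3 : ∀ p, bernExp p (stateWeight δ) ≤ 1 + δ := by
      intro p
      refine bernExp_le fun d => ?_
      cases d <;> simp [stateWeight]
      linarith
    unfold stateExp
    rcases h.getLast? with _ | x
    · exact h3 _
    · dsimp only
      split_ifs
      · exact h3 _
      · exact le_rfl
  have h4 := law_real_hist_le P init π (n := t) F
    (fun h => le_trans (by positivity) (hF0 h)) (c := (1 / 4) ^ K) (by positivity)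
    {x | completed (hist t x) < K} fun x hx =>
      (pow_le_pow_of_le_one (by norm_num) (by norm_num) (le_of_lt hx)).trans (hF0 _)
  refine h4.trans ?_
  have h5 := integral_hist_le_pow P init π hρ0.le F hstep t
  have h6 : F [] ≤ 2 := by simp [hF, completed]; linarith
  calc _ ≤ ((1 / 4 : ℝ) ^ K)⁻¹ * (ρ ^ t * 2) := by
        refine mul_le_mul_of_nonneg_left (h5.trans ?_) (by positivity)
        exact mul_le_mul_of_nonneg_left h6 (by positivity)
    _ = _ := by rw [one_div, inv_pow, inv_inv]; ring

end

/-! ### Regret as the accumulated loss; identification of `V*` and `Q*` -/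

section
variable {M : ℕ} (P : Model M) (init : ℕ → unitInterval) (π : Policy M) (b : Fin M)

/-- The expected reward at time `t`, counted within the first `K` episodes. -/
noncomputable def stepReward (K t : ℕ) : ℝ :=
  ∫ x, (if completed (hist t x) < K then (if (x t).reward then (1 : ℝ) else 0) else 0)
    ∂(law P init π)

/-- The expected loss at time `t`, counted within the first `K` episodes. -/
noncomputable def stepLoss (K t : ℕ) : ℝ :=
  ∫ x, (if completed (hist t x) < K then loss P b (x t).state (x t).arm else 0) ∂(law P init π)

lemma measurable_hist_step {β : Type*} [MeasurableSpace β] (n : ℕ)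
    (F : List (Step M) → Step M → β) :
    Measurable fun x : ℕ → Step M => F (hist n x) (x n) := by
  have h : Measurable fun z : (Fin n → Step M) × Step M => F (List.ofFn z.1) z.2 :=
    Measurable.of_discrete
  have h' : Measurable fun x : ℕ → Step M => ((fun i : Fin n => x i), x n) :=
    (measurable_pi_lambda _ fun i => measurable_pi_apply _).prodMk (measurable_pi_apply n)
  exact h.comp h'

lemma integrable_hist_step (n : ℕ) (F : List (Step M) → Step M → ℝ) :
    Integrable (fun x => F (hist n x) (x n)) (law P init π) := by
  obtain ⟨C, hC⟩ := (Set.finite_range fun z : (Fin n → Step M) × Step M =>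
    |F (List.ofFn z.1) z.2|).bddAbove
  exact Integrable.of_bound (measurable_hist_step n F).aestronglyMeasurable C
    (Eventually.of_forall fun x => hC ⟨(fun i => x i, x n), rfl⟩)

lemma measurableSet_hist (n : ℕ) (p : List (Step M) → Prop) :
    MeasurableSet {x : ℕ → Step M | p (hist n x)} :=
  measurableSet_setOfPred.2 (measurable_hist n p)

lemma measurableSet_hist_step (n : ℕ) (p : List (Step M) → Step M → Prop) :
    MeasurableSet {x : ℕ → Step M | p (hist n x) (x n)} :=
  measurableSet_setOfPred.2 (measurable_hist_step n p)

variable {P b}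

/-- The martingale identity `stepExp_remaining`, telescoped over `n` steps. -/
lemma sum_stepReward_add_stepLoss (K n : ℕ) :
    ∑ t ∈ Finset.range n, (stepReward P init π K t + stepLoss P init π b K t) =
      remaining P init b K [] - ∫ x, remaining P init b K (hist n x) ∂(law P init π) := by
  induction n with
  | zero => simp
  | succ n ih =>
    rw [Finset.sum_range_succ, ih]
    have h1 : ∫ x, remaining P init b K (hist n x) ∂(law P init π) =
        ∫ x, remaining P init b K (hist (n + 1) x) ∂(law P init π) +
          (stepReward P init π K n + stepLoss P init π b K n) := by
      rw [stepReward, stepLoss, ← integral_add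
        (integrable_hist_step P init π n fun h y =>
          if completed h < K then (if y.reward then (1 : ℝ) else 0) else 0)
        (integrable_hist_step P init π n fun h y =>
          if completed h < K then loss P b y.state y.arm else 0),
        ← integral_add (integrable_hist P init π (n + 1) (remaining P init b K))
        (integrable_hist_step P init π n fun h y =>
          (if completed h < K then (if y.reward then (1 : ℝ) else 0) else 0) +
          if completed h < K then loss P b y.state y.arm else 0)]
      have h2 := integral_step P init π n fun h y => remaining P init b K (h ++ [y]) +
        if completed h < K then (if y.reward then 1 else 0) + loss P b y.state y.arm else 0
      simp only [stepExp_remaining] at h2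
      rw [← h2]
      refine integral_congr_ae (Eventually.of_forall fun x => ?_)
      simp only [hist_succ]
      split_ifs <;> simp
    linarith

lemma exists_abs_loss_le : ∃ C : ℝ, 0 ≤ C ∧ ∀ s a, |loss P b s a| ≤ C := by
  obtain ⟨C, hC⟩ := (Set.finite_range fun z : Bool × Fin M => |loss P b z.1 z.2|).bddAbove
  exact ⟨C, (abs_nonneg _).trans (hC ⟨(true, b), rfl⟩), fun s a => hC ⟨(s, a), rfl⟩⟩

lemma integral_ite_completed (K n : ℕ) (c : ℝ) :
    ∫ x, (if completed (hist n x) < K then c else 0) ∂(law P init π) =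
      c * (law P init π).real {x | completed (hist n x) < K} := by
  have := integral_indicator_const (μ := law P init π) c
    (measurableSet_hist n fun h => completed h < K)
  rw [smul_eq_mul, mul_comm] at this
  rw [← this]
  refine integral_congr_ae (Eventually.of_forall fun x => ?_)
  simp [Set.indicator_apply]

lemma abs_stepLoss_le {C : ℝ} (hC : ∀ s a, |loss P b s a| ≤ C) (K t : ℕ) :
    |stepLoss P init π b K t| ≤ C * (law P init π).real {x | completed (hist t x) < K} := by
  rw [stepLoss, ← integral_ite_completed]
  refine (abs_integral_le_integral_abs).trans (integral_mono (μ := law P init π)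
    (integrable_hist_step P init π t fun h y =>
      |if completed h < K then loss P b y.state y.arm else 0|)
    (integrable_hist P init π t fun h => if completed h < K then C else 0) fun x => ?_)
  dsimp only
  split_ifs
  · exact hC _ _
  · simp

lemma stepReward_nonneg (K t : ℕ) : 0 ≤ stepReward P init π K t :=
  integral_nonneg fun x => by dsimp only; split_ifs <;> simp

lemma lintegral_rewardAt (K t : ℕ) :
    ∫⁻ x, rewardAt K x t ∂(law P init π) = ENNReal.ofReal (stepReward P init π K t) := by
  rw [stepReward, ofReal_integral_eq_lintegral_ofReal
    (integrable_hist_step P init π t fun h y =>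
      if completed h < K then (if y.reward then (1 : ℝ) else 0) else 0)
    (Eventually.of_forall fun x => by dsimp only; split_ifs <;> simp)]
  refine lintegral_congr fun x => ?_
  rw [rewardAt, episode_eq]
  by_cases h1 : completed (hist t x) < K <;> by_cases h2 : (x t).reward <;> simp [h1, h2]

lemma measurable_rewardAt (K t : ℕ) : Measurable fun x : ℕ → Step M => rewardAt K x t := by
  have : (fun x : ℕ → Step M => rewardAt K x t) = fun x =>
      (fun (h : List (Step M)) (y : Step M) =>
        if completed h < K ∧ y.reward = true then (1 : ℝ≥0∞) else 0) (hist t x) (x t) := by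
    funext x
    rw [rewardAt, episode_eq]
  rw [this]
  exact measurable_hist_step t fun (h : List (Step M)) (y : Step M) =>
    if completed h < K ∧ y.reward = true then (1 : ℝ≥0∞) else 0

lemma remaining_nil {K : ℕ} :
    remaining P init b K [] = ∑ k ∈ Finset.range K, episodeValue P init b k := by
  rw [remaining]
  split_ifs with h
  · simp only [completed, List.countP_nil] at h ⊢
    rw [Finset.range_eq_Ico, Finset.sum_eq_sum_Ico_succ_bot h]
    rfl
  · simp only [completed, List.countP_nil, not_lt, nonpos_iff_eq_zero] at h
    simp [h]

lemma episodeValue_startAt (s : Bool) (k : ℕ) :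
    episodeValue P (startAt s) b k = optV P b s := by
  cases s <;> simp [episodeValue, startAt, bernExp]

lemma stateExp_startAt_nil (s : Bool) (g : Bool → ℝ) :
    stateExp (M := M) (startAt s) [] g = g s := by
  cases s <;> simp [stateExp, startAt, bernExp]

lemma stepLoss_eq_zero (hb : P.mean b < 1)
    (hq : 0 < P.quit false false) {K t : ℕ} (hπ : ∀ s h, h.length = t → π s h = b) :
    stepLoss P init π b K t = 0 := by
  rw [stepLoss, integral_eq_zero_of_ae]
  filter_upwards [ae_arm P init π] with x hx
  rw [hx, hπ _ _ (length_hist t x), loss_self hb hq]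
  simp

lemma optQ_nonneg (hb : P.mean b < 1) (hq : 0 < P.quit false false)
    (s : Bool) (a : Fin M) : 0 ≤ optQ P b s a := by
  refine (bernExp_const (P.mean a) 0).symm.trans_le (bernExp_mono fun r =>
    add_nonneg (by split_ifs <;> norm_num)
      (mul_nonneg (sub_nonneg.2 (P.quit s r).2.2) (optV_nonneg hb hq r)))

variable (hm : ∀ a, P.mean a ≤ P.mean b) (hb : P.mean b < 1) (hq : 0 < P.quit false false)
include hm hb hq

lemma summable_completed (K : ℕ) :
    Summable fun t => (law P init π).real {x | completed (hist t x) < K} := by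
  obtain ⟨ρ, h0, h1, h⟩ := exists_completed_tail hm hb hq
  exact Summable.of_nonneg_of_le (fun _ => measureReal_nonneg) (fun t => h init π t K)
    (((summable_geometric_of_lt_one h0.le h1).mul_left 2).mul_right _)

lemma summable_stepLoss (K : ℕ) : Summable (stepLoss P init π b K) := by
  obtain ⟨C, -, hC⟩ := exists_abs_loss_le (P := P) (b := b)
  exact Summable.of_norm_bounded ((summable_completed init π hm hb hq K).mul_left C)
    (abs_stepLoss_le init π hC K)

/-- The rewards under any policy fall short of the optimal values by the accumulated losses. -/
lemma hasSum_stepReward (K : ℕ) : HasSum (stepReward P init π K)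
    (∑ k ∈ Finset.range K, episodeValue P init b k - ∑' t, stepLoss P init π b K t) := by
  have hc := (summable_completed init π hm hb hq K)
  have h1 : Summable (stepReward P init π K) := by
    refine Summable.of_nonneg_of_le (stepReward_nonneg init π K) (fun t => ?_) hc
    rw [← one_mul ((law P init π).real _), ← integral_ite_completed]
    refine integral_mono (integrable_hist_step P init π t fun h y =>
      if completed h < K then (if y.reward then (1 : ℝ) else 0) else 0)
      (integrable_hist P init π t fun h => if completed h < K then (1 : ℝ) else 0) fun x => ?_
    dsimp only
    split_ifs <;> simp
  have h2 := summable_stepLoss init π hm hb hq K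
  have h3 := (h1.add h2).hasSum.tendsto_sum_nat
  -- `remaining` is bounded and vanishes once `K` episodes are complete.
  have h4 : Tendsto (fun n => ∫ x, remaining P init b K (hist n x) ∂(law P init π)) atTop
      (nhds 0) := by
    have h5 := (hc.mul_left ((1 + K) * (optV P b true + optV P b false))).tendsto_atTop_zero
    refine squeeze_zero (fun n => integral_nonneg fun x => remaining_nonneg init hb hq K _)
      (fun n => ?_) h5
    rw [← integral_ite_completed]
    exact integral_mono (integrable_hist P init π n (remaining P init b K))
      (integrable_hist P init π n fun h => if completed h < K then
        (1 + K) * (optV P b true + optV P b false) else 0) fun x => remaining_le init hb hq K _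
  simp only [sum_stepReward_add_stepLoss, remaining_nil] at h3
  have h6 := tendsto_nhds_unique h3 (h4.const_sub _)
  rw [h1.tsum_add h2] at h6
  have h7 := h1.hasSum
  convert h7 using 1
  linarith

/-- Tonelli for the nonnegative rewards. The form `ENNReal.ofReal` also gives finiteness. -/
lemma expReward_eq (K : ℕ) : expReward P init π K = ENNReal.ofReal
    (∑ k ∈ Finset.range K, episodeValue P init b k - ∑' t, stepLoss P init π b K t) := by
  have h := hasSum_stepReward init π hm hb hq K
  rw [expReward, lintegral_tsum fun t => (measurable_rewardAt K t).aemeasurable, ← h.tsum_eq,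
    ENNReal.ofReal_tsum_of_nonneg (stepReward_nonneg init π K) h.summable]
  simp only [lintegral_rewardAt]

lemma toReal_expReward (K : ℕ) : (expReward P init π K).toReal =
    ∑ k ∈ Finset.range K, episodeValue P init b k - ∑' t, stepLoss P init π b K t := by
  rw [expReward_eq init π hm hb hq, ENNReal.toReal_ofReal]
  rw [← (hasSum_stepReward init π hm hb hq K).tsum_eq]
  exact tsum_nonneg (stepReward_nonneg init π K)

lemma toReal_expReward_always (K : ℕ) : (expReward P init (always b) K).toReal =
    ∑ k ∈ Finset.range K, episodeValue P init b k := by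
  rw [toReal_expReward init (always b) hm hb hq]
  simp [stepLoss_eq_zero init (always b) hb hq (fun _ _ _ => rfl)]

/-- The regret is the accumulated loss. -/
lemma regret_eq (K : ℕ) : regret P init b π K = ∑' t, stepLoss P init π b K t := by
  rw [regret, toReal_expReward_always init hm hb hq, toReal_expReward init π hm hb hq]
  ring

lemma valueV_eq (s : Bool) : valueV P b s = ENNReal.ofReal (optV P b s) := by
  rw [valueV, expReward_eq (startAt s) (always b) hm hb hq]
  simp [stepLoss_eq_zero (startAt s) (always b) hb hq (fun _ _ _ => rfl),
    episodeValue_startAt]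

/-- The policy `firstThen a b` can lose only at time 0, so its episode is worth `optV - loss =
optQ`. The first reward has mean `P.mean a`, and removing it leaves the series in `valueQ`. -/
lemma valueQ_eq (s : Bool) (a : Fin M) : valueQ P b s a = ENNReal.ofReal (optQ P b s a) := by
  have h := hasSum_stepReward (startAt s) (firstThen a b) hm hb hq 1
  have hl : ∑' t, stepLoss P (startAt s) (firstThen a b) b 1 t = loss P b s a := by
    rw [tsum_eq_single 0 fun t ht => stepLoss_eq_zero _ _ hb hq fun s h hh => by
      have : h ≠ [] := by rintro rfl; exact ht hh.symm
      simp [firstThen, this]]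
    have h1 := integral_step P (startAt s) (firstThen a b) 0 fun h y =>
      if completed h < 1 then loss P b y.state y.arm else 0
    rw [stepLoss, h1]
    simp [completed, stepExp, bernExp_const, stateExp_startAt_nil, firstThen]
  have hr : stepReward P (startAt s) (firstThen a b) 1 0 = P.mean a := by
    have h1 := integral_step P (startAt s) (firstThen a b) 0 fun h y =>
      if completed h < 1 then (if y.reward then (1 : ℝ) else 0) else 0
    rw [stepReward, h1]
    simp [completed, stepExp, stateExp_startAt_nil, firstThen]
    simp [bernExp]
  rw [hl, Finset.sum_range_one, episodeValue_startAt, loss, sub_sub_cancel,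
    hasSum_nat_add_iff' 1 |>.symm, Finset.sum_range_one, hr] at h
  have hnn := stepReward_nonneg (P := P) (startAt s) (firstThen a b) 1
  rw [valueQ, lintegral_tsum fun t => (measurable_rewardAt 1 (t + 1)).aemeasurable]
  simp only [lintegral_rewardAt]
  rw [← ENNReal.ofReal_tsum_of_nonneg (fun t => hnn (t + 1)) h.summable, h.tsum_eq,
    ← ENNReal.ofReal_add (P.mean a).2.1 (by
      rw [← h.tsum_eq]; exact tsum_nonneg fun t => hnn (t + 1))]
  congr 1
  ring

lemma gap_eq (s : Bool) (a : Fin M) : gap P b s a = loss P b s a := by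
  rw [gap, valueV_eq hm hb hq, valueQ_eq hm hb hq, ENNReal.toReal_ofReal (optV_nonneg hb hq s),
    ENNReal.toReal_ofReal (optQ_nonneg hb hq s a), loss]

/-- The loss factors as `(μ(b) - μ(a)) * (1 + (1 - q(1,1)) * V(1) - (1 - q(1,0)) * V(0))`. The
second factor is positive because `q(1,1) ≤ q(1,0)` and `V(0) ≤ V(1)`, and the latter holds because
state 1 has the smaller abandonment probabilities. -/
lemma loss_true_nonneg (hquit : ∀ i j i' j' : Bool, i.toNat + j.toNat < i'.toNat + j'.toNat →
      P.quit i' j' ≤ P.quit i j) (a : Fin M) : 0 ≤ loss P b true a := by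
  have h11 : (P.quit true true : ℝ) ≤ P.quit true false := hquit _ _ _ _ (by simp)
  have h01 : (P.quit true true : ℝ) ≤ P.quit false true := hquit _ _ _ _ (by simp)
  have h00 : (P.quit true false : ℝ) ≤ P.quit false false := hquit _ _ _ _ (by simp)
  have hv := optV_nonneg hb hq
  have hma : (P.mean a : ℝ) ≤ P.mean b := hm a
  have hb0 := (P.mean b).2.1
  have hb1 := (P.mean b).2.2
  have hv01 : optV P b false ≤ optV P b true := by
    rw [optV_eq hb hq false, optV_eq hb hq true]
    refine bernExp_mono fun r => ?_
    have := mul_le_mul_of_nonneg_right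
      (show 1 - (P.quit false r : ℝ) ≤ 1 - P.quit true r by cases r <;> linarith) (hv r)
    linarith
  have h1 : (1 - (P.quit true false : ℝ)) * optV P b false ≤
      (1 - P.quit true true) * optV P b true :=
    mul_le_mul (by linarith) hv01 (hv _) (by linarith [(P.quit true true).2.2])
  rw [loss, optV_eq hb hq true]
  simp only [optQ, bernExp, if_true, Bool.false_eq_true, if_false]
  nlinarith

end

/-! ### Concentration of empirical means along the trajectory -/

/-- Hoeffding's lemma for Bernoulli variables. -/
lemma bernExp_exp_le (p : unitInterval) (l : ℝ) :
    bernExp p (fun r => Real.exp (l * ((if r then 1 else 0) - p))) ≤ Real.exp (l ^ 2 / 8) := by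
  have h := (hasSubgaussianMGF_of_mem_Icc (μ := bernoulliMeasure true false p)
    (X := fun r : Bool => if r then (1 : ℝ) else 0) (a := 0) (b := 1)
    (Measurable.of_discrete.aemeasurable)
    (Eventually.of_forall fun r => by cases r <;> simp)).mgf_le l
  rw [mgf, integral_bernoulliMeasure, integral_bernoulliMeasure] at h
  simp only [smul_eq_mul, if_true, Bool.false_eq_true, if_false, mul_one, mul_zero,
    add_zero] at h
  simp only [bernExp, if_true, Bool.false_eq_true, if_false]
  refine h.trans_eq ?_
  congr 1
  norm_num
  ring

/-- How often a pull of arm `a` was rewarded. -/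
def wins {M : ℕ} (h : List (Step M)) (a : Fin M) : ℕ :=
  h.countP fun x => x.arm = a ∧ x.reward = true

/-- The first `s` rewards of arm `a`. -/
def firstRewards {M : ℕ} (a : Fin M) (s : ℕ) (h : List (Step M)) : List Bool :=
  ((h.filter fun x => x.arm = a).map fun x => x.reward).take s

section
variable {M : ℕ} (P : Model M) (init : ℕ → unitInterval) (π : Policy M)

lemma pulls_append (h : List (Step M)) (y : Step M) (a : Fin M) :
    pulls (h ++ [y]) a = pulls h a + if y.arm = a then 1 else 0 := by
  by_cases hy : y.arm = a <;> simp [pulls, List.countP_append, hy]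

lemma pulls_le_length (h : List (Step M)) (a : Fin M) : pulls h a ≤ h.length :=
  List.countP_le_length

lemma pulls_mono {m n : ℕ} (hmn : m ≤ n) (x : ℕ → Step M) (a : Fin M) :
    pulls (hist m x) a ≤ pulls (hist n x) a :=
  (hist_prefix hmn x).sublist.countP_le

lemma empMean_eq (h : List (Step M)) (a : Fin M) :
    empMean h a = (wins h a : ℝ) / (pulls h a : ℝ) := rfl

lemma firstRewards_append (a : Fin M) (s : ℕ) (h : List (Step M)) (y : Step M) :
    firstRewards a s (h ++ [y]) = if y.arm = a ∧ (firstRewards a s h).length < s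
      then firstRewards a s h ++ [y.reward] else firstRewards a s h := by
  by_cases hy : y.arm = a
  · simp only [firstRewards, List.filter_append, List.map_append, hy, List.length_take,
      true_and]
    simp only [hy, List.filter_cons, decide_true, if_true, List.filter_nil, List.map_cons,
      List.map_nil]
    split_ifs with h1
    · rw [List.take_append, List.take_of_length_le (l := [y.reward])]
      simp only [List.length_cons, List.length_nil]
      rw [List.length_map] at h1 ⊢
      omega
    · rw [List.take_append_of_le_length]
      omega
  · simp [firstRewards, hy]

/-- The sample is frozen once it is complete. An event at an unknown time `u ≤ T` can thus be read
off at time `T`, with no union over `u`. -/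
lemma firstRewards_of_prefix {a : Fin M} {h h' : List (Step M)} (hp : h <+: h') :
    firstRewards a (pulls h a) h' = (h.filter fun x => x.arm = a).map fun x => x.reward := by
  obtain ⟨t, rfl⟩ := hp
  rw [firstRewards, List.filter_append, List.map_append, List.take_append_of_le_length,
    List.take_of_length_le] <;> simp [pulls, List.countP_eq_length_filter]

/-- The exponential supermartingale of the first `s` rewards of arm `a`. -/
noncomputable def expDev (a : Fin M) (s : ℕ) (l : ℝ) (h : List (Step M)) : ℝ :=
  Real.exp (l * ((firstRewards a s h).count true - P.mean a * (firstRewards a s h).length) -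
    l ^ 2 / 8 * (firstRewards a s h).length)

/-- A step that enlarges the sample is controlled by Hoeffding's lemma; any other step leaves
`expDev` unchanged. -/
lemma stepExp_expDev_le (a : Fin M) (s : ℕ) (l : ℝ) (h : List (Step M)) :
    stepExp P init π h (fun y => expDev P a s l (h ++ [y])) ≤ expDev P a s l h := by
  refine (stateExp_mono _ fun s' => ?_).trans_eq (stateExp_const init h _)
  by_cases hc : π s' h = a ∧ (firstRewards a s h).length < s
  · have h1 : ∀ r d, expDev P a s l (h ++ [⟨s', π s' h, r, d⟩]) = expDev P a s l h *
        Real.exp (-(l ^ 2 / 8)) * Real.exp (l * ((if r then 1 else 0) - P.mean a)) := by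
      intro r d
      rw [expDev, firstRewards_append, if_pos (by simpa using hc), expDev, ← Real.exp_add,
        ← Real.exp_add]
      congr 1
      cases r <;> simp [List.count_append] <;> ring
    simp only [h1, bernExp_const, bernExp_mul_left]
    rw [hc.1]
    have h2 := bernExp_exp_le (P.mean a) l
    calc _ ≤ expDev P a s l h * Real.exp (-(l ^ 2 / 8)) * Real.exp (l ^ 2 / 8) :=
          mul_le_mul_of_nonneg_left h2 (mul_nonneg (Real.exp_nonneg _) (Real.exp_nonneg _))
      _ = _ := by rw [mul_assoc, ← Real.exp_add]; simp
  · have h1 : ∀ r d, expDev P a s l (h ++ [⟨s', π s' h, r, d⟩]) = expDev P a s l h := by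
      intro r d
      rw [expDev, firstRewards_append, if_neg (by simpa using hc), expDev]
    simp only [h1, bernExp_const]
    exact le_rfl

lemma wins_eq_count (h : List (Step M)) (a : Fin M) :
    wins h a = ((h.filter fun x => x.arm = a).map fun x => x.reward).count true := by
  rw [wins, List.count, List.countP_map, List.countP_filter]
  congr 1
  funext x
  by_cases h1 : x.arm = a <;> by_cases h2 : x.reward <;> simp [h1, h2]

/-- Maximal Hoeffding bound for the average of the first `s` rewards of arm `a`. -/
lemma law_dev_le (a : Fin M) (s T : ℕ) {y l : ℝ} (hl : l ^ 2 = 16 * y ^ 2) :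
    (law P init π).real {x | ∃ u ≤ T, pulls (hist u x) a = s ∧
      4 * y ^ 2 * s ≤ l * (wins (hist u x) a - P.mean a * s)} ≤ Real.exp (-2 * s * y ^ 2) := by
  have h := law_real_hist_le P init π (n := T) (expDev P a s l) (fun h => (Real.exp_nonneg _))
    (c := Real.exp (2 * s * y ^ 2)) (Real.exp_pos _)
    {x | ∃ u ≤ T, pulls (hist u x) a = s ∧
      4 * y ^ 2 * s ≤ l * (wins (hist u x) a - P.mean a * s)} (by
    rintro x ⟨u, hu, hs, hd⟩
    have h1 := firstRewards_of_prefix (a := a) (hist_prefix hu x)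
    have h2 : ((hist u x).filter fun x => x.arm = a).length = s := by
      rw [← hs, pulls, List.countP_eq_length_filter]
    rw [hs] at h1
    -- Both `l = 4 * y` and `l = -4 * y` are allowed, for the two tails. The exponent is at least `4
    -- * y ^ 2 * s - l ^ 2 / 8 * s = 2 * y ^ 2 * s`.
    rw [expDev, h1, ← wins_eq_count, List.length_map, h2]
    refine Real.exp_le_exp.2 ?_
    rw [hl]
    linarith)
  have h3 := integral_hist_le_pow P init π zero_le_one (expDev P a s l)
    (fun h => (stepExp_expDev_le P init π a s l h).trans_eq (one_mul _).symm) T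
  rw [one_pow, one_mul] at h3
  have h4 : expDev P a s l [] = 1 := by simp [expDev, firstRewards]
  rw [h4] at h3
  refine h.trans ((mul_le_of_le_one_right (by positivity) h3).trans_eq ?_)
  rw [← Real.exp_neg]
  congr 1
  ring

/-- Bound on the probability that the average reward of arm `a` ever deviates by `ε` beyond the
confidence radius of level `F`, once it has been pulled at least `m` times. -/
lemma law_empMean_dev_le (a : Fin M) (m T : ℕ) {ε F σ : ℝ} (hε : 0 < ε) (hF : 0 ≤ F)
    (hσ : σ ^ 2 = 1) :
    (law P init π).real {x | ∃ u ≤ T, m ≤ pulls (hist u x) a ∧ 1 ≤ pulls (hist u x) a ∧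
      ε + √(F / (2 * pulls (hist u x) a)) ≤ σ * (empMean (hist u x) a - P.mean a)} ≤
    Real.exp (-F) * (Real.exp (-2 * ε ^ 2) ^ m / (1 - Real.exp (-2 * ε ^ 2))) := by
  set r := Real.exp (-2 * ε ^ 2) with hr
  have hr1 : r < 1 := by
    rw [hr, Real.exp_lt_one_iff]
    nlinarith [sq_pos_of_pos hε]
  have hr0 : 0 ≤ r := Real.exp_nonneg _
  set y : ℕ → ℝ := fun s => ε + √(F / (2 * s)) with hy
  set A : ℕ → Set (ℕ → Step M) := fun s => {x | ∃ u ≤ T, pulls (hist u x) a = s ∧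
      4 * y s ^ 2 * s ≤ (4 * σ * y s) * (wins (hist u x) a - P.mean a * s)} with hA
  have h1 : {x : ℕ → Step M | ∃ u ≤ T, m ≤ pulls (hist u x) a ∧ 1 ≤ pulls (hist u x) a ∧
      ε + √(F / (2 * pulls (hist u x) a)) ≤ σ * (empMean (hist u x) a - P.mean a)} ⊆
      ⋃ s ∈ Finset.Ico (max m 1) (T + 1), A s := by
    rintro x ⟨u, hu, hm, h1, hd⟩
    have hu' : pulls (hist u x) a ≤ u := (pulls_le_length _ _).trans_eq (length_hist u x)
    simp only [Set.mem_iUnion, Finset.mem_Ico]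
    refine ⟨pulls (hist u x) a, ⟨max_le hm h1, by omega⟩, u, hu, rfl, ?_⟩
    have hs : (0 : ℝ) < pulls (hist u x) a := by exact_mod_cast h1
    have hy0 : 0 ≤ y (pulls (hist u x) a) := add_nonneg hε.le (Real.sqrt_nonneg _)
    rw [empMean_eq] at hd
    have h2 : (wins (hist u x) a : ℝ) - P.mean a * pulls (hist u x) a =
        ((wins (hist u x) a : ℝ) / pulls (hist u x) a - P.mean a) * pulls (hist u x) a := by
      field_simp
    rw [h2]
    have h3 := mul_le_mul_of_nonneg_left hd
      (mul_nonneg (mul_nonneg (by norm_num : (0 : ℝ) ≤ 4) hy0) hs.le)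
    calc _ = 4 * y (pulls (hist u x) a) * pulls (hist u x) a *
          (ε + √(F / (2 * pulls (hist u x) a))) := by simp only [hy]; ring
      _ ≤ _ := h3
      _ = _ := by ring
  have h2 : ∀ s ∈ Finset.Ico (max m 1) (T + 1),
      (law P init π).real (A s) ≤ Real.exp (-F) * r ^ s := by
    intro s hs
    have hs1 : (0 : ℝ) < s := by
      have := (Finset.mem_Ico.1 hs).1
      have : 1 ≤ s := (le_max_right _ _).trans this
      exact_mod_cast this
    -- Expanding `2 * s * (ε + √(F / (2 * s))) ^ 2` and dropping the cross term leaves at least `F +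
    -- 2 * s * ε ^ 2`, hence a geometric series in `s`.
    refine (law_dev_le P init π a s T (by rw [mul_pow, mul_pow, hσ]; ring)).trans ?_
    rw [hr, ← Real.exp_nat_mul, ← Real.exp_add]
    refine Real.exp_le_exp.2 ?_
    have h4 : √(F / (2 * s)) ^ 2 = F / (2 * s) := Real.sq_sqrt (by positivity)
    have h5 : s * (F / (2 * s)) = F / 2 := by field_simp
    have h6 : 0 ≤ s * (ε * √(F / (2 * s))) := by positivity
    simp only [hy]
    nlinarith
  calc _ ≤ (law P init π).real (⋃ s ∈ Finset.Ico (max m 1) (T + 1), A s) :=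
        measureReal_mono h1 (measure_ne_top _ _)
    _ ≤ ∑ s ∈ Finset.Ico (max m 1) (T + 1), (law P init π).real (A s) :=
        measureReal_biUnion_finset_le _ _
    _ ≤ ∑ s ∈ Finset.Ico (max m 1) (T + 1), Real.exp (-F) * r ^ s := Finset.sum_le_sum h2
    _ ≤ ∑ s ∈ Finset.Ico m (T + 1), Real.exp (-F) * r ^ s :=
        Finset.sum_le_sum_of_subset_of_nonneg
          (Finset.Ico_subset_Ico_left (le_max_left _ _)) fun _ _ _ => by positivity
    _ ≤ _ := by
        rw [← Finset.mul_sum]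
        exact mul_le_mul_of_nonneg_left (geom_sum_Ico_le_of_lt_one hr0 hr1) (Real.exp_nonneg _)

/-! ### State 1 occurs linearly often -/

/-- How often the state was `true`. -/
def trueStates (h : List (Step M)) : ℕ := h.countP fun x => x.state

/-- The state is `true` linearly often, with exponentially small exceptional probability. -/
lemma exists_trueStates_tail {c : ℝ} (hc0 : 0 < c) (hc1 : c ≤ 1)
    (hc : ∀ s a, c ≤ P.mean a * (1 - P.quit s true)) :
    ∃ ρ β : ℝ, 0 < ρ ∧ ρ < 1 ∧ 0 < β ∧ ∀ (init : ℕ → unitInterval) (π : Policy M) (t : ℕ),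
      (law P init π).real {x | (trueStates (hist t x) : ℝ) < β * t} ≤ 2 * ρ ^ t := by
  obtain ⟨ρ', hρ'⟩ : ∃ ρ' : ℝ, ρ' = 1 - c / 2 := ⟨_, rfl⟩
  have hρ0 : 0 < ρ' := by linarith
  have hρ1 : ρ' < 1 := by linarith
  have hs0 : 0 < √ρ' := Real.sqrt_pos.2 hρ0
  have hs1 : √ρ' < 1 := by rwa [Real.sqrt_lt' one_pos, one_pow]
  -- With `2 ^ β = 1 / √ρ'`, the factor `2 ^ (β * t + 1)` from Markov's inequality consumes half of
  -- the decay `ρ' ^ t`.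
  have h2β : (2 : ℝ) ^ Real.logb 2 (√ρ')⁻¹ = (√ρ')⁻¹ :=
    Real.rpow_logb two_pos (by norm_num) (inv_pos.2 hs0)
  have hβ : 0 < Real.logb 2 (√ρ')⁻¹ := Real.logb_pos one_lt_two ((one_lt_inv₀ hs0).2 hs1)
  set β := Real.logb 2 (√ρ')⁻¹
  refine ⟨√ρ', β, hs0, hs1, hβ, fun init π t => ?_⟩
  -- Each visit to state 1 halves the weight. A visit already certain to come next is credited in
  -- advance, so every step gains on average, whatever the current state.
  set F : List (Step M) → ℝ := fun h => (1 / 2) ^ trueStates h *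
    match h.getLast? with
      | none => 1
      | some x => if x.reward ∧ ¬ x.left then 1 / 2 else 1 with hF
  have hF0 : ∀ h, (1 / 2) ^ (trueStates h + 1) ≤ F h := by
    intro h
    rw [pow_succ]
    refine mul_le_mul_of_nonneg_left ?_ (by positivity)
    rcases h.getLast? with _ | x
    · norm_num
    · dsimp only
      split_ifs <;> norm_num
  have hstep : ∀ h, stepExp P init π h (fun y => F (h ++ [y])) ≤ ρ' * F h := by
    intro h
    have h1 : ∀ y : Step M, F (h ++ [y]) = (1 / 2) ^ trueStates h *
        ((if y.state then 1 / 2 else 1) * if y.reward ∧ ¬ y.left then 1 / 2 else 1) := by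
      intro y
      simp only [hF, List.getLast?_concat, trueStates, List.countP_append]
      by_cases hy : y.state <;> simp [hy, pow_succ, mul_assoc]
    have h2 : stepExp P init π h (fun y => F (h ++ [y])) ≤
        stateExp init h fun s => ((1 / 2) ^ trueStates h * ρ') * if s then 1 / 2 else 1 := by
      refine stateExp_mono _ fun s => ?_
      simp only [h1, bernExp_mul_left]
      rw [mul_assoc, mul_comm ρ']
      refine mul_le_mul_of_nonneg_left ?_ (by positivity)
      have h3 : ∀ (u : ℝ) (G : Bool → Bool → ℝ), bernExp (P.mean (π s h)) (fun r =>
          bernExp (P.quit s r) fun d => u * G r d) = u * bernExp (P.mean (π s h)) (fun r =>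
          bernExp (P.quit s r) fun d => G r d) := fun u G => by simp only [bernExp_mul_left]
      refine (h3 (if s then 1 / 2 else 1) fun r d => if r ∧ ¬ d then 1 / 2 else 1).trans_le ?_
      refine mul_le_mul_of_nonneg_left (a := if s then (1 / 2 : ℝ) else 1) ?_
        (by split_ifs <;> norm_num)
      have := hc s (π s h)
      simp only [bernExp, hρ']
      norm_num
      linarith
    refine h2.trans ?_
    rw [stateExp_mul_left, mul_comm _ ρ', mul_assoc]
    refine mul_le_mul_of_nonneg_left (mul_le_mul_of_nonneg_left ?_ (by positivity)) hρ0.le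
    have h3 : ∀ p, bernExp p (fun s => if s then (1 / 2 : ℝ) else 1) ≤ 1 := fun p =>
      bernExp_le fun d => by split_ifs <;> norm_num
    unfold stateExp
    rcases h.getLast? with _ | x
    · exact h3 _
    · dsimp only
      by_cases hl : x.left
      · simpa [hl] using h3 (init (completed h))
      · by_cases hr : x.reward <;> simp [hl, hr]
  have h4 := law_real_hist_le P init π (n := t) F
    (fun h => le_trans (by positivity) (hF0 h)) (c := (1 / 2 : ℝ) ^ (β * t + 1))
    (Real.rpow_pos_of_pos (by norm_num) _)
    {x | (trueStates (hist t x) : ℝ) < β * t} fun x hx => by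
      refine le_trans ?_ (hF0 _)
      rw [← Real.rpow_natCast]
      refine Real.rpow_le_rpow_of_exponent_ge (by norm_num) (by norm_num) ?_
      push_cast
      linarith [show (trueStates (hist t x) : ℝ) < β * t from hx]
  refine h4.trans ?_
  have h5 := integral_hist_le_pow P init π hρ0.le F hstep t
  have h6 : F [] = 1 := by simp [hF, trueStates]
  have h7 : ((1 / 2 : ℝ) ^ (β * t + 1))⁻¹ = 2 * ((√ρ')⁻¹) ^ t := by
    rw [one_div, Real.inv_rpow two_pos.le, inv_inv, Real.rpow_add two_pos, Real.rpow_one,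
      Real.rpow_mul two_pos.le, h2β, Real.rpow_natCast, mul_comm]
  rw [h6, mul_one] at h5
  rw [h7]
  refine (mul_le_mul_of_nonneg_left h5 (by positivity)).trans_eq ?_
  rw [mul_assoc, ← mul_pow]
  congr 2
  rw [inv_mul_eq_div, Real.div_sqrt]

end

/-! ### Growth and summability of the exploration level -/

/-- The exploration level at time `n`, truncated at zero. -/
noncomputable def level (n : ℕ) : ℝ := max (Real.log n + 4 * Real.log (Real.log n)) 0

lemma level_nonneg (n : ℕ) : 0 ≤ level n := le_max_right _ _

lemma one_lt_log_natCast {n : ℕ} (hn : 3 ≤ n) : 1 < Real.log n := by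
  have h3 : (3 : ℝ) ≤ n := by exact_mod_cast hn
  rw [Real.lt_log_iff_exp_lt (by linarith)]
  linarith [Real.exp_one_lt_d9]

lemma level_eq {n : ℕ} (hn : 3 ≤ n) : level n = Real.log n + 4 * Real.log (Real.log n) := by
  have h1 := one_lt_log_natCast hn
  exact max_eq_left (by linarith [Real.log_pos h1])

/-- At 0 and 1 both logarithms have the default value or the value 0; at 2, `log (log 2)` is
negative enough. -/
lemma level_of_lt {n : ℕ} (hn : n < 3) : level n = 0 := by
  refine max_eq_right ?_
  interval_cases n
  · simp
  · simp
  · have h2 : Real.log 2 < 0.6931471808 := Real.log_two_lt_d9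
    have h3 : 0 < Real.log 2 := Real.log_pos one_lt_two
    have := Real.log_le_sub_one_of_pos h3
    push_cast
    linarith

lemma level_mono : Monotone level := by
  intro m n hmn
  by_cases hm : m < 3
  · rw [level_of_lt hm]; exact level_nonneg n
  · have hm3 : 3 ≤ m := not_lt.1 hm
    have h1 := one_lt_log_natCast hm3
    have hm0 : (0 : ℝ) < m := by exact_mod_cast (by omega : 0 < m)
    have h2 : Real.log m ≤ Real.log n := Real.log_le_log hm0 (by exact_mod_cast hmn)
    rw [level_eq hm3, level_eq (hm3.trans hmn)]
    linarith [Real.log_le_log (by linarith) h2]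

lemma level_le (n : ℕ) : level n ≤ 5 * Real.log n := by
  by_cases hn : n < 3
  · rw [level_of_lt hn]
    exact mul_nonneg (by norm_num) (Real.log_natCast_nonneg n)
  · have h1 := one_lt_log_natCast (not_lt.1 hn)
    rw [level_eq (not_lt.1 hn)]
    linarith [Real.log_le_sub_one_of_pos (show 0 < Real.log n by linarith)]

lemma exp_neg_level {n : ℕ} (hn : 3 ≤ n) :
    Real.exp (-level n) = (n * Real.log n ^ 4)⁻¹ := by
  have h1 := one_lt_log_natCast hn
  have hn0 : (0 : ℝ) < n := by exact_mod_cast (by omega : 0 < n)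
  rw [level_eq hn, Real.exp_neg, Real.exp_add, Real.exp_log hn0]
  congr 2
  rw [show 4 * Real.log (Real.log n) = ((4 : ℕ) : ℝ) * Real.log (Real.log n) by norm_num,
    Real.exp_nat_mul, Real.exp_log (by linarith)]

lemma exp_neg_level_antitone : Antitone fun n => Real.exp (-level n) :=
  fun _ _ h => Real.exp_le_exp.2 (neg_le_neg (level_mono h))

/-- The terms are `1 / (n * log n ^ 4)`; Cauchy condensation turns them into a multiple of `1 / k ^
4`. -/
lemma summable_exp_neg_level : Summable fun n => Real.exp (-level n) := by
  rw [← summable_condensed_iff_of_nonneg (fun n => (Real.exp_nonneg _))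
    fun _ _ _ h => exp_neg_level_antitone h]
  have h1 : Summable fun k : ℕ => (Real.log 2 ^ 4)⁻¹ * (1 / (k : ℝ) ^ 4) :=
    (Real.summable_one_div_nat_pow.2 (by norm_num)).mul_left _
  refine Summable.of_norm_bounded_eventually_nat h1 ?_
  filter_upwards [eventually_ge_atTop 2] with k hk
  have h2 : 3 ≤ 2 ^ k := le_trans (by norm_num) (Nat.pow_le_pow_right two_pos hk)
  rw [exp_neg_level h2]
  push_cast
  rw [Real.log_pow]
  have hl : 0 < Real.log 2 := Real.log_pos one_lt_two
  have hk0 : (0 : ℝ) < k := by exact_mod_cast (by omega : 0 < k)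
  rw [Real.norm_of_nonneg (by positivity)]
  refine le_of_eq ?_
  field_simp

/-- For `n ≥ β⁻¹ ^ 2` one has `log (β * n) ≥ log n / 2`, so rescaling time costs at most a factor `2
^ 4 / β`. -/
lemma summable_exp_neg_level_ceil {β : ℝ} (hβ : 0 < β) :
    Summable fun n : ℕ => Real.exp (-level ⌈β * n⌉₊) := by
  refine Summable.of_norm_bounded_eventually_nat (summable_exp_neg_level.mul_left (16 / β)) ?_
  filter_upwards [eventually_ge_atTop 3, eventually_ge_atTop ⌈(β⁻¹) ^ 2⌉₊,
    eventually_ge_atTop ⌈3 / β⌉₊] with n hn3 hn1 hn2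
  have hn0 : (0 : ℝ) < n := by exact_mod_cast (by omega : 0 < n)
  have h1 : (β⁻¹) ^ 2 ≤ n := Nat.ceil_le.1 hn1
  have h2 : 3 ≤ β * n := by
    have := Nat.ceil_le.1 hn2
    rw [div_le_iff₀ hβ] at this
    linarith
  have hk : β * n ≤ (⌈β * n⌉₊ : ℝ) := Nat.le_ceil _
  have hk3 : 3 ≤ ⌈β * n⌉₊ := by exact_mod_cast h2.trans hk
  have h3 : Real.log n / 2 ≤ Real.log (⌈β * n⌉₊ : ℝ) := by
    have h4 : Real.log n / 2 ≤ Real.log (β * n) := by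
      rw [Real.log_mul hβ.ne' hn0.ne']
      have := Real.log_le_log (by positivity) h1
      rw [Real.log_pow, Real.log_inv] at this
      push_cast at this
      linarith
    exact h4.trans (Real.log_le_log (by positivity) hk)
  have hl := one_lt_log_natCast hn3
  have hlk := one_lt_log_natCast hk3
  have hp1 : 0 < (⌈β * n⌉₊ : ℝ) * Real.log (⌈β * n⌉₊ : ℝ) ^ 4 :=
    mul_pos (by linarith) (pow_pos (by linarith) 4)
  have hp2 : 0 < β * (n * Real.log n ^ 4) := mul_pos hβ (mul_pos hn0 (pow_pos (by linarith) 4))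
  rw [Real.norm_of_nonneg (Real.exp_nonneg _), exp_neg_level hk3, exp_neg_level hn3,
    ← div_eq_mul_inv, div_div, inv_eq_one_div, div_le_div_iff₀ hp1 hp2, one_mul]
  have h5 : (Real.log n / 2) ^ 4 ≤ Real.log (⌈β * n⌉₊ : ℝ) ^ 4 :=
    pow_le_pow_left₀ (by linarith) h3 4
  calc β * (n * Real.log n ^ 4) = 16 * (β * n * (Real.log n / 2) ^ 4) := by ring
    _ ≤ _ := by gcongr

lemma eventually_level_le {δ : ℝ} (hδ : 0 < δ) (c : ℝ) :
    ∀ᶠ n : ℕ in atTop, level (n + 1) ≤ δ * n - c := by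
  have h1 : Tendsto (fun n : ℕ => Real.log n / n) atTop (nhds 0) := by
    have := Real.isLittleO_log_id_atTop.tendsto_div_nhds_zero
    exact this.comp tendsto_natCast_atTop_atTop
  have h2 := (h1.comp (tendsto_add_atTop_nat 1)).eventually
    (gt_mem_nhds (show (0 : ℝ) < δ / 10 by positivity))
  have h3 := tendsto_natCast_atTop_atTop.eventually_ge_atTop (2 * (c / δ) + 1)
  filter_upwards [h2, h3] with n hn hc
  have hn1 : (0 : ℝ) < (n + 1 : ℕ) := by positivity
  simp only [Function.comp] at hn
  rw [div_lt_iff₀ hn1] at hn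
  have h4 := level_le (n + 1)
  have h5 : δ * (2 * (c / δ) + 1) ≤ δ * n := mul_le_mul_of_nonneg_left hc hδ.le
  have h6 : δ * (2 * (c / δ) + 1) = 2 * c + δ := by field_simp
  push_cast at *
  linarith

lemma tendsto_level_mul_div_log {C : ℕ} (hC : 0 < C) :
    Tendsto (fun K : ℕ => level (C * K) / Real.log K) atTop (nhds 1) := by
  have hlog : Tendsto (fun K : ℕ => Real.log (K : ℝ)) atTop atTop :=
    Real.tendsto_log_atTop.comp tendsto_natCast_atTop_atTop
  have hCK : Tendsto (fun K : ℕ => ((C * K : ℕ) : ℝ)) atTop atTop :=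
    tendsto_natCast_atTop_atTop.comp (tendsto_id.const_mul_atTop' hC)
  have h1 : Tendsto (fun K : ℕ => Real.log ((C * K : ℕ) : ℝ) / Real.log K) atTop (nhds 1) := by
    have h2 : Tendsto (fun K : ℕ => Real.log C / Real.log (K : ℝ) + 1) atTop (nhds (0 + 1)) :=
      (hlog.const_div_atTop _).add_const 1
    rw [zero_add] at h2
    refine h2.congr' ?_
    filter_upwards [eventually_ge_atTop 3] with K hK
    have hl := one_lt_log_natCast hK
    have hK0 : (K : ℝ) ≠ 0 := by exact_mod_cast (by omega : K ≠ 0)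
    have hC0 : (C : ℝ) ≠ 0 := by exact_mod_cast hC.ne'
    push_cast
    rw [Real.log_mul hC0 hK0, add_div, div_self (by linarith)]
  have h3 : Tendsto (fun K : ℕ => Real.log (Real.log ((C * K : ℕ) : ℝ)) /
      Real.log ((C * K : ℕ) : ℝ)) atTop (nhds 0) :=
    Real.isLittleO_log_id_atTop.tendsto_div_nhds_zero.comp (Real.tendsto_log_atTop.comp hCK)
  have h4 := h1.mul ((h3.const_mul 4).const_add 1)
  rw [mul_zero, add_zero, mul_one] at h4
  refine h4.congr' ?_
  filter_upwards [eventually_ge_atTop 3] with K hK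
  have hCK3 : 3 ≤ C * K := hK.trans (Nat.le_mul_of_pos_left K hC)
  have hl := one_lt_log_natCast hCK3
  rw [level_eq hCK3]
  field_simp

/-! ### Optimism: suboptimal pulls in state 1 -/

section
variable {M : ℕ} {P : Model M} {init : ℕ → unitInterval} {π : Policy M}

lemma law_real_mono_of_arm {A B : Set (ℕ → Step M)}
    (h : ∀ x, (∀ n, (x n).arm = π (x n).state (hist n x)) → x ∈ A → x ∈ B) :
    (law P init π).real A ≤ (law P init π).real B := by
  refine ENNReal.toReal_mono (measure_ne_top _ _) (measure_mono_ae ?_)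
  filter_upwards [ae_arm P init π] with x hx using h x hx

/-- Truncating the level is harmless since `√` is 0 on negative numbers. -/
lemma index_four (C : ℝ) (h : List (Step M)) (a : Fin M) :
    index 4 C h a = empMean h a + C * √(level (h.length + 1) / (2 * pulls h a)) := by
  rw [index, level]
  congr 2
  rcases le_total 0 (Real.log (h.length + 1 : ℕ) +
    4 * Real.log (Real.log (h.length + 1 : ℕ))) with h0 | h0
  · rw [max_eq_left h0]
  · rw [max_eq_right h0, zero_div, Real.sqrt_zero]
    exact Real.sqrt_eq_zero_of_nonpos (div_nonpos_of_nonpos_of_nonneg h0 (by positivity))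

/-- A repeated pull shows that the initial round is over, so the index rule applies. -/
lemma IsULCB.compare (hπ : IsULCB (-1) 1 4 π) {s : Bool} {h : List (Step M)}
    (hp : pulls h (π s h) ≠ 0) (a : Fin M) : pulls h a ≠ 0 ∧
      empMean h a + (if s then 1 else -1) * √(level (h.length + 1) / (2 * pulls h a)) ≤
      empMean h (π s h) +
        (if s then 1 else -1) * √(level (h.length + 1) / (2 * pulls h (π s h))) := by
  have h1 : ∀ a, pulls h a ≠ 0 := fun a ha => hp ((hπ s h).1 ⟨a, ha⟩)
  refine ⟨h1 a, ?_⟩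
  have h2 := (hπ s h).2 h1 a
  rwa [index_four, index_four] at h2

variable (P init π)

/-- Every value of the pull counter is passed at most once. -/
lemma sum_law_pull_le (a : Fin M) (s n : ℕ) (p : List (Step M) → Prop) :
    ∑ t ∈ Finset.range n, (law P init π).real
      {x | (x t).arm = a ∧ pulls (hist t x) a = s ∧ p (hist t x)} ≤
    (law P init π).real {x | ∃ u ≤ n, pulls (hist u x) a = s ∧ p (hist u x)} := by
  have hd : ∀ t t' : ℕ, t < t' → Disjoint
      {x : ℕ → Step M | (x t).arm = a ∧ pulls (hist t x) a = s ∧ p (hist t x)}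
      {x | (x t').arm = a ∧ pulls (hist t' x) a = s ∧ p (hist t' x)} := by
    intro t t' htt
    rw [Set.disjoint_left]
    rintro x ⟨h1, h2, -⟩ ⟨-, h3, -⟩
    have h4 := pulls_mono (Nat.succ_le_of_lt htt) x a
    rw [Nat.succ_eq_add_one, hist_succ, pulls_append, if_pos h1] at h4
    omega
  rw [← measureReal_biUnion_finset]
  · refine measureReal_mono ?_ (measure_ne_top _ _)
    intro x hx
    simp only [Set.mem_iUnion, Finset.mem_range] at hx
    obtain ⟨t, ht, h⟩ := hx
    exact ⟨t, ht.le, h.2⟩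
  · intro t _ t' _ hne
    rcases lt_or_gt_of_ne hne with h | h
    · exact hd t t' h
    · exact (hd t' t h).symm
  · intro t _
    exact measurableSet_hist_step t fun h y => y.arm = a ∧ pulls h a = s ∧ p h

lemma sum_law_pull_lt_le (a : Fin M) (k n : ℕ) :
    ∑ t ∈ Finset.range n, (law P init π).real {x | (x t).arm = a ∧ pulls (hist t x) a < k} ≤
      k := by
  have h1 : ∀ t ∈ Finset.range n,
      (law P init π).real {x | (x t).arm = a ∧ pulls (hist t x) a < k} ≤
      ∑ s ∈ Finset.range k, (law P init π).real
        {x | (x t).arm = a ∧ pulls (hist t x) a = s ∧ True} := by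
    intro t _
    refine le_trans (measureReal_mono ?_ (measure_ne_top _ _)) (measureReal_biUnion_finset_le _ _)
    rintro x ⟨h1, h2⟩
    simp only [Set.mem_iUnion, Finset.mem_range]
    exact ⟨_, h2, h1, rfl, trivial⟩
  refine (Finset.sum_le_sum h1).trans ?_
  rw [Finset.sum_comm]
  refine (Finset.sum_le_sum fun s _ => (sum_law_pull_le P init π a s n fun _ => True).trans
    measureReal_le_one).trans ?_
  simp

/-- The sum is reorganized by the value `s` of the pull counter. Each value is passed at most once,
so the Hoeffding bounds form a geometric series and the total does not grow with `n`. -/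
lemma sum_law_pull_dev_le (a : Fin M) (n : ℕ) {ε : ℝ} (hε : 0 < ε) :
    ∑ t ∈ Finset.range n, (law P init π).real {x | (x t).arm = a ∧ 1 ≤ pulls (hist t x) a ∧
      ε ≤ empMean (hist t x) a - P.mean a} ≤ (1 - Real.exp (-2 * ε ^ 2))⁻¹ := by
  have h1 : ∀ t ∈ Finset.range n,
      (law P init π).real {x | (x t).arm = a ∧ 1 ≤ pulls (hist t x) a ∧
        ε ≤ empMean (hist t x) a - P.mean a} ≤
      ∑ s ∈ Finset.range n, (law P init π).real {x | (x t).arm = a ∧ pulls (hist t x) a = s ∧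
        4 * ε ^ 2 * s ≤ (4 * ε) * (wins (hist t x) a - P.mean a * s)} := by
    intro t ht
    refine le_trans (measureReal_mono ?_ (measure_ne_top _ _)) (measureReal_biUnion_finset_le _ _)
    rintro x ⟨h1, h2, h3⟩
    simp only [Set.mem_iUnion, Finset.mem_range]
    have h4 : pulls (hist t x) a ≤ t := (pulls_le_length _ _).trans_eq (length_hist t x)
    refine ⟨_, h4.trans_lt (Finset.mem_range.1 ht), h1, rfl, ?_⟩
    have hs : (0 : ℝ) < pulls (hist t x) a := by exact_mod_cast h2
    rw [empMean_eq, le_sub_iff_add_le, le_div_iff₀ hs] at h3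
    nlinarith
  refine (Finset.sum_le_sum h1).trans ?_
  rw [Finset.sum_comm]
  have hr1 : Real.exp (-2 * ε ^ 2) < 1 := by
    rw [Real.exp_lt_one_iff]
    nlinarith [sq_pos_of_pos hε]
  calc _ ≤ ∑ s ∈ Finset.range n, Real.exp (-2 * ε ^ 2) ^ s := by
        refine Finset.sum_le_sum fun s _ => ?_
        have h2 := sum_law_pull_le P init π a s n fun h =>
          4 * ε ^ 2 * s ≤ (4 * ε) * (wins h a - P.mean a * s)
        have h3 : (law P init π).real {x | ∃ u ≤ n, pulls (hist u x) a = s ∧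
            4 * ε ^ 2 * s ≤ (4 * ε) * (wins (hist u x) a - P.mean a * s)} ≤
              Real.exp (-2 * s * ε ^ 2) :=
          law_dev_le P init π a s n (by ring)
        refine (h2.trans h3).trans_eq ?_
        rw [← Real.exp_nat_mul]
        congr 1
        ring
    _ ≤ _ := by
        rw [← tsum_geometric_of_lt_one (Real.exp_nonneg _) hr1]
        exact (summable_geometric_of_lt_one (Real.exp_nonneg _) hr1).sum_le_tsum _
          fun _ _ => pow_nonneg (Real.exp_nonneg _) _

variable {π}

/-- The optimistic choices in state `true` of a suboptimal arm. -/
lemma exists_sum_law_true_le (hπ : IsULCB (-1) 1 4 π) (a b : Fin M) {ε : ℝ} (hε : 0 < ε)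
    (hab : P.mean a + 2 * ε < (P.mean b : ℝ)) :
    ∃ C : ℝ, ∀ n : ℕ, ∑ t ∈ Finset.range n,
      (law P init π).real {x | (x t).state = true ∧ (x t).arm = a} ≤
        level n / (2 * ((P.mean b : ℝ) - P.mean a - 2 * ε) ^ 2) + C := by
  obtain ⟨D, hD⟩ : ∃ D : ℝ, D = (P.mean b : ℝ) - P.mean a - 2 * ε := ⟨_, rfl⟩
  have hD0 : 0 < D := by linarith
  set q := Real.exp (-2 * ε ^ 2) with hq
  have hq1 : q < 1 := by
    rw [hq, Real.exp_lt_one_iff]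
    nlinarith [sq_pos_of_pos hε]
  have hs := ((summable_nat_add_iff 1).2 summable_exp_neg_level).mul_right (q ^ 0 / (1 - q))
  refine ⟨2 + (1 - q)⁻¹ + ∑' t, Real.exp (-level (t + 1)) * (q ^ 0 / (1 - q)), fun n => ?_⟩
  rw [← hD]
  -- Beyond `L` pulls the radius of `a` is at most `D`. A pull of `a` then has one of three causes:
  -- few pulls, an overestimate of `a`, or an underestimate of `b`.
  set L := level n / (2 * D ^ 2) with hL
  have hL0 : 0 ≤ L := div_nonneg (level_nonneg n) (by positivity)
  have h1 : ∀ t ∈ Finset.range n,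
      (law P init π).real {x | (x t).state = true ∧ (x t).arm = a} ≤
      (law P init π).real {x | (x t).arm = a ∧ pulls (hist t x) a < ⌈L + 1⌉₊} +
      (law P init π).real {x | (x t).arm = a ∧ 1 ≤ pulls (hist t x) a ∧
        ε ≤ empMean (hist t x) a - P.mean a} +
      Real.exp (-level (t + 1)) * (q ^ 0 / (1 - q)) := by
    intro t ht
    have ht' : t + 1 ≤ n := Finset.mem_range.1 ht
    have h2 := law_empMean_dev_le P init π b 0 t hε (level_nonneg (t + 1)) (σ := -1) (by norm_num)
    refine le_trans ?_ (add_le_add_right h2 _)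
    refine le_trans ?_ ((measureReal_union_le _ _).trans
      (add_le_add_left (measureReal_union_le _ _) _))
    refine law_real_mono_of_arm ?_
    rintro x hx ⟨hst, ha⟩
    by_contra hne
    simp only [Set.mem_union, not_or] at hne
    obtain ⟨⟨h3, h4⟩, h5⟩ := hne
    have h6 : ⌈L + 1⌉₊ ≤ pulls (hist t x) a := by
      by_contra h; exact h3 ⟨ha, not_le.1 h⟩
    have h7 : L + 1 ≤ (pulls (hist t x) a : ℝ) := Nat.ceil_le.1 h6
    have h8 : 1 ≤ pulls (hist t x) a := by
      have : (1 : ℝ) ≤ pulls (hist t x) a := by linarith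
      exact_mod_cast this
    have h9 : empMean (hist t x) a - P.mean a < ε := by
      by_contra h; exact h4 ⟨ha, h8, not_lt.1 h⟩
    have hax : π true (hist t x) = a := by rw [← ha, hx t, hst]
    have h10 := hπ.compare (s := true) (h := hist t x) (by rw [hax]; omega) b
    simp only [hax, if_true, one_mul, length_hist] at h10
    have h11 : √(level (t + 1) / (2 * pulls (hist t x) a)) ≤ D := by
      rw [Real.sqrt_le_left hD0.le, div_le_iff₀ (by linarith)]
      have h12 : level n = L * (2 * D ^ 2) := by rw [hL]; field_simp
      have h13 := level_mono ht'
      nlinarith [sq_pos_of_pos hD0]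
    refine h5 ⟨t, le_rfl, Nat.zero_le _, Nat.one_le_iff_ne_zero.2 h10.1, ?_⟩
    -- The index of `b` is at most that of `a`, hence below `μ(a) + ε + D = μ(b) - ε`.
    linarith [h10.2]
  refine (Finset.sum_le_sum h1).trans ?_
  rw [Finset.sum_add_distrib, Finset.sum_add_distrib]
  have h2 := sum_law_pull_lt_le P init π a ⌈L + 1⌉₊ n
  have h3 := sum_law_pull_dev_le P init π a n hε
  have h4 := hs.sum_le_tsum (Finset.range n) fun t _ =>
    mul_nonneg (Real.exp_nonneg _) (div_nonneg (pow_nonneg (Real.exp_nonneg _) 0)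
      (sub_nonneg.2 hq1.le))
  have h5 := Nat.ceil_lt_add_one (show 0 ≤ L + 1 by linarith)
  linarith

end

/-! ### Linear exploration of the best arm; pessimism in state 0 -/

section
variable {M : ℕ} (P : Model M) (init : ℕ → unitInterval) {π : Policy M}

/-- How often arm `a` was pulled in state `true`. -/
def truePulls (h : List (Step M)) (a : Fin M) : ℕ := h.countP fun x => x.state = true ∧ x.arm = a

lemma truePulls_append (h : List (Step M)) (y : Step M) (a : Fin M) :
    truePulls (h ++ [y]) a = truePulls h a + if y.state = true ∧ y.arm = a then 1 else 0 := by
  by_cases hy : y.state = true ∧ y.arm = a <;> simp [truePulls, List.countP_append, hy]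

lemma truePulls_le_pulls (h : List (Step M)) (a : Fin M) : truePulls h a ≤ pulls h a :=
  List.countP_mono_left fun x _ hx => by simp_all

lemma sum_truePulls (h : List (Step M)) : ∑ a, truePulls h a = trueStates h := by
  induction h using List.reverseRecOn with
  | nil => simp [truePulls, trueStates]
  | append_singleton h y ih =>
    simp only [truePulls_append, Finset.sum_add_distrib, ih]
    by_cases hy : y.state = true <;> simp [trueStates, List.countP_append, hy]

/-- Take `u` to be the time of the `k`-th pull of `a` in state 1. -/
lemma exists_last_truePull {a : Fin M} {k t : ℕ} {x : ℕ → Step M} (hk : 1 ≤ k)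
    (h : k ≤ truePulls (hist t x) a) :
    ∃ u < t, (x u).state = true ∧ (x u).arm = a ∧ k - 1 ≤ pulls (hist u x) a := by
  induction t with
  | zero => simp [truePulls] at h; omega
  | succ t ih =>
    by_cases h1 : k ≤ truePulls (hist t x) a
    · obtain ⟨u, hu, h2⟩ := ih h1
      exact ⟨u, by omega, h2⟩
    · rw [hist_succ, truePulls_append] at h
      split_ifs at h with h2
      · refine ⟨t, by omega, h2.1, h2.2, ?_⟩
        have := truePulls_le_pulls (hist t x) a
        omega
      · omega

lemma summable_geometric_ceil {q β : ℝ} (hq0 : 0 < q) (hq1 : q < 1) (hβ : 0 < β) (j : ℕ) :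
    Summable fun t : ℕ => q ^ (⌈β * t⌉₊ - j) := by
  have h1 : q ^ β < 1 := Real.rpow_lt_one hq0.le hq1 hβ
  refine Summable.of_nonneg_of_le (fun t => pow_nonneg hq0.le _) (fun t => ?_)
    ((summable_geometric_of_lt_one (Real.rpow_nonneg hq0.le β) h1).mul_left (q ^ (-(j : ℝ))))
  rw [← Real.rpow_natCast, ← Real.rpow_natCast, ← Real.rpow_mul hq0.le, ← Real.rpow_add hq0]
  refine Real.rpow_le_rpow_of_exponent_ge hq0 hq1.le ?_
  have h2 : (⌈β * t⌉₊ : ℝ) ≤ (⌈β * t⌉₊ - j : ℕ) + j := by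
    exact_mod_cast (by omega : ⌈β * t⌉₊ ≤ (⌈β * t⌉₊ - j) + j)
  linarith [Nat.le_ceil (β * t)]

/-- The best arm is pulled linearly often, outside events of summable probability. -/
lemma exists_summable_pulls_lt (hπ : IsULCB (-1) 1 4 π) (b : Fin M) {c ε : ℝ} (hc0 : 0 < c)
    (hc1 : c ≤ 1) (hc : ∀ s a, c ≤ P.mean a * (1 - P.quit s true)) (hε : 0 < ε)
    (hgap : ∀ a, a ≠ b → P.mean a + 3 * ε ≤ (P.mean b : ℝ)) :
    ∃ β : ℝ, 0 < β ∧ Summable fun t : ℕ =>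
      (law P init π).real {x | (pulls (hist t x) b : ℝ) < β * t} := by
  obtain ⟨ρ, β₁, hρ0, hρ1, hβ₁, htail⟩ := exists_trueStates_tail P hc0 hc1 hc
  have hM : (0 : ℝ) < M := by exact_mod_cast b.pos
  -- Pigeonhole: among `M` arms, one receives at least a share `1 / M` of the visits to state 1.
  set β := β₁ / M with hβ
  have hβ0 : 0 < β := div_pos hβ₁ hM
  refine ⟨β, hβ0, ?_⟩
  set q := Real.exp (-2 * ε ^ 2) with hq
  have hq0 : 0 < q := Real.exp_pos _
  have hq1 : q < 1 := by
    rw [hq, Real.exp_lt_one_iff]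
    nlinarith [sq_pos_of_pos hε]
  have hsum : Summable fun t : ℕ => 2 * ρ ^ t +
      (∑ _a : Fin M, Real.exp (-0) * (q ^ (⌈β * t⌉₊ - 1) / (1 - q)) +
        Real.exp (-level ⌈β * t⌉₊) * (q ^ 0 / (1 - q))) := by
    refine ((summable_geometric_of_lt_one hρ0.le hρ1).mul_left 2).add (Summable.add ?_ ?_)
    · exact summable_sum fun a _ => ((summable_geometric_ceil hq0 hq1 hβ0 1).div_const _).mul_left _
    · exact (summable_exp_neg_level_ceil hβ0).mul_right _
  refine Summable.of_norm_bounded_eventually_nat hsum ?_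
  filter_upwards [eventually_level_le (show 0 < 2 * ε ^ 2 * β by positivity) (2 * ε ^ 2),
    eventually_ge_atTop ⌈2 / β⌉₊] with t hlev ht
  have ht2 : 2 ≤ β * t := by
    have := Nat.ceil_le.1 ht
    rw [div_le_iff₀ hβ0] at this
    linarith
  have hkr : β * t ≤ (⌈β * t⌉₊ : ℝ) := Nat.le_ceil _
  have hk2 : 2 ≤ ⌈β * t⌉₊ := by exact_mod_cast ht2.trans hkr
  rw [Real.norm_of_nonneg measureReal_nonneg]
  set k := ⌈β * t⌉₊ with hk
  refine le_trans ?_ (add_le_add (htail init π t) (add_le_add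
    (Finset.sum_le_sum fun a _ => law_empMean_dev_le P init π a (k - 1) t hε le_rfl (σ := 1)
      (by norm_num))
    (law_empMean_dev_le P init π b 0 t hε (level_nonneg k) (σ := -1) (by norm_num))))
  refine le_trans ?_ (add_le_add_right (add_le_add_left (measureReal_biUnion_finset_le _ _) _) _)
  refine le_trans ?_ (add_le_add_right (measureReal_union_le _ _) _)
  refine le_trans ?_ (measureReal_union_le _ _)
  refine law_real_mono_of_arm (π := π) ?_
  intro x hx hlt
  replace hlt : (pulls (hist t x) b : ℝ) < β * t := hlt
  by_contra hne
  simp only [Set.mem_union, not_or, Set.mem_iUnion, not_exists] at hne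
  obtain ⟨h1, h2, h3⟩ := hne
  replace h1 : β₁ * t ≤ (trueStates (hist t x) : ℝ) := not_lt.1 h1
  obtain ⟨a, ha⟩ : ∃ a, β * t ≤ (truePulls (hist t x) a : ℝ) := by
    by_contra hn
    push Not at hn
    have h4 : ∑ a, (truePulls (hist t x) a : ℝ) < ∑ _a : Fin M, β * t :=
      Finset.sum_lt_sum_of_nonempty ⟨b, Finset.mem_univ b⟩ fun a _ => hn a
    rw [← Nat.cast_sum, sum_truePulls, Finset.sum_const, Finset.card_univ, Fintype.card_fin,
      nsmul_eq_mul, hβ] at h4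
    have h5 : (M : ℝ) * (β₁ / M * t) = β₁ * t := by field_simp
    linarith
  have hab : a ≠ b := by
    rintro rfl
    have : (truePulls (hist t x) a : ℝ) ≤ pulls (hist t x) a := by
      exact_mod_cast truePulls_le_pulls _ _
    linarith
  obtain ⟨u, hu, hst, hau, hpu⟩ := exists_last_truePull (by omega) (Nat.ceil_le.2 ha)
  rw [← hk] at hpu
  have hax : π true (hist u x) = a := by rw [← hau, hx u, hst]
  have hcmp := hπ.compare (s := true) (h := hist u x) (by rw [hax]; omega) b
  simp only [hax, if_true, one_mul, length_hist] at hcmp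
  have hna : empMean (hist u x) a - P.mean a < ε := by
    by_contra h
    refine h2 a (Finset.mem_univ a) ⟨u, hu.le, hpu, by omega, ?_⟩
    rw [zero_div, Real.sqrt_zero, add_zero, one_mul]
    exact not_lt.1 h
  have hpk : (k : ℝ) - 1 ≤ pulls (hist u x) a := by
    have : (k : ℝ) ≤ (pulls (hist u x) a + 1 : ℕ) := by
      exact_mod_cast (by omega : k ≤ pulls (hist u x) a + 1)
    push_cast at this
    linarith
  have hra : √(level (u + 1) / (2 * pulls (hist u x) a)) ≤ ε := by
    rw [Real.sqrt_le_left hε.le, div_le_iff₀ (by linarith)]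
    have h6 : level (u + 1) ≤ level (t + 1) := level_mono (by omega)
    have h7 : 2 * ε ^ 2 * (β * t - 1) ≤ 2 * ε ^ 2 * pulls (hist u x) a :=
      mul_le_mul_of_nonneg_left (by linarith) (by positivity)
    linarith
  have hup : pulls (hist u x) a ≤ u := (pulls_le_length _ _).trans_eq (length_hist u x)
  -- There were at least `k - 1` earlier pulls, so `k ≤ u + 1`. The unknown level at time `u` can be
  -- replaced by the deterministic `level k`.
  have hrb : √(level k / (2 * pulls (hist u x) b)) ≤
      √(level (u + 1) / (2 * pulls (hist u x) b)) :=
    Real.sqrt_le_sqrt (div_le_div_of_nonneg_right (level_mono (by omega)) (by positivity))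
  refine h3 ⟨u, hu.le, Nat.zero_le _, Nat.one_le_iff_ne_zero.2 hcmp.1, ?_⟩
  linarith [hcmp.2, hgap a hab]

/-- The pessimistic choices in state `false` of a suboptimal arm. -/
lemma exists_sum_law_false_le (hπ : IsULCB (-1) 1 4 π) (b : Fin M) {c ε : ℝ} (hc0 : 0 < c)
    (hc1 : c ≤ 1) (hc : ∀ s a, c ≤ P.mean a * (1 - P.quit s true)) (hε : 0 < ε)
    (hgap : ∀ a, a ≠ b → P.mean a + 3 * ε ≤ (P.mean b : ℝ)) (a : Fin M) (ha : a ≠ b) :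
    ∃ C : ℝ, ∀ n : ℕ, ∑ t ∈ Finset.range n,
      (law P init π).real {x | (x t).state = false ∧ (x t).arm = a} ≤ C := by
  obtain ⟨β, hβ0, hβs⟩ := exists_summable_pulls_lt P init hπ b hc0 hc1 hc hε hgap
  set q := Real.exp (-2 * ε ^ 2) with hq
  have hq0 : 0 < q := Real.exp_pos _
  have hq1 : q < 1 := by
    rw [hq, Real.exp_lt_one_iff]
    nlinarith [sq_pos_of_pos hε]
  have hsum : Summable fun t : ℕ => (law P init π).real {x | (pulls (hist t x) b : ℝ) < β * t} +
      (Real.exp (-level (t + 1)) * (q ^ 0 / (1 - q)) +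
        Real.exp (-0) * (q ^ (⌈β * t⌉₊ - 0) / (1 - q))) :=
    hβs.add ((((summable_nat_add_iff 1).2 summable_exp_neg_level).mul_right _).add
      (((summable_geometric_ceil hq0 hq1 hβ0 0).div_const _).mul_left _))
  have hs : Summable fun t : ℕ => (law P init π).real
      {x | (x t).state = false ∧ (x t).arm = a ∧ pulls (hist t x) a ≠ 0} := by
    refine Summable.of_norm_bounded_eventually_nat hsum ?_
    filter_upwards [eventually_level_le (show 0 < 2 * ε ^ 2 * β by positivity) 0,
      eventually_ge_atTop 1] with t hlev ht
    have ht0 : (0 : ℝ) < t := by exact_mod_cast ht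
    have hkr : β * t ≤ (⌈β * t⌉₊ : ℝ) := Nat.le_ceil _
    rw [Real.norm_of_nonneg measureReal_nonneg]
    refine le_trans ?_ (add_le_add_right (add_le_add
      (law_empMean_dev_le P init π a 0 t hε (level_nonneg (t + 1)) (σ := 1) (by norm_num))
      (law_empMean_dev_le P init π b (⌈β * t⌉₊ - 0) t hε le_rfl (σ := -1) (by norm_num))) _)
    refine le_trans ?_ (add_le_add_right (measureReal_union_le _ _) _)
    refine le_trans ?_ (measureReal_union_le _ _)
    refine law_real_mono_of_arm (π := π) ?_
    rintro x hx ⟨hst, hat, hp⟩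
    by_contra hne
    simp only [Set.mem_union, not_or] at hne
    obtain ⟨h1, h2, h3⟩ := hne
    replace h1 : β * t ≤ (pulls (hist t x) b : ℝ) := not_lt.1 h1
    have hax : π false (hist t x) = a := by rw [← hat, hx t, hst]
    have hcmp := hπ.compare (s := false) (h := hist t x) (by rwa [hax]) b
    simp only [hax, Bool.false_eq_true, if_false, length_hist] at hcmp
    have hda : empMean (hist t x) a - P.mean a <
        ε + √(level (t + 1) / (2 * pulls (hist t x) a)) := by
      by_contra h
      refine h2 ⟨t, le_rfl, Nat.zero_le _, Nat.one_le_iff_ne_zero.2 hp, ?_⟩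
      rw [one_mul]
      exact not_lt.1 h
    have hdb : -1 * (empMean (hist t x) b - P.mean b) < ε := by
      by_contra h
      refine h3 ⟨t, le_rfl, ?_, Nat.one_le_iff_ne_zero.2 hcmp.1, ?_⟩
      · rw [Nat.sub_zero]
        exact Nat.ceil_le.2 h1
      · rw [zero_div, Real.sqrt_zero, add_zero]
        exact not_lt.1 h
    have hrb : √(level (t + 1) / (2 * pulls (hist t x) b)) ≤ ε := by
      have h5 : 0 < β * t := by positivity
      rw [Real.sqrt_le_left hε.le, div_le_iff₀ (by linarith)]
      have h7 : 2 * ε ^ 2 * (β * t) ≤ 2 * ε ^ 2 * pulls (hist t x) b :=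
        mul_le_mul_of_nonneg_left h1 (by positivity)
      linarith
    -- The lower index of `a` is below `μ(a) + ε`, while that of `b` exceeds `μ(b) - 2 * ε`.
    linarith [hcmp.2, hgap a ha]
  -- The summand 1 pays for the initial pull of `a`, which the index rule does not govern.
  refine ⟨1 + ∑' t, (law P init π).real
    {x | (x t).state = false ∧ (x t).arm = a ∧ pulls (hist t x) a ≠ 0}, fun n => ?_⟩
  have h1 : ∀ t ∈ Finset.range n,
      (law P init π).real {x | (x t).state = false ∧ (x t).arm = a} ≤
      (law P init π).real {x | (x t).arm = a ∧ pulls (hist t x) a < 1} + (law P init π).real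
        {x | (x t).state = false ∧ (x t).arm = a ∧ pulls (hist t x) a ≠ 0} := by
    intro t _
    refine le_trans (measureReal_mono ?_ (measure_ne_top _ _)) (measureReal_union_le _ _)
    rintro x ⟨h1, h2⟩
    by_cases h3 : pulls (hist t x) a = 0
    · exact Or.inl ⟨h2, by omega⟩
    · exact Or.inr ⟨h1, h2, h3⟩
  refine (Finset.sum_le_sum h1).trans ?_
  rw [Finset.sum_add_distrib]
  refine add_le_add ((sum_law_pull_lt_le P init π a 1 n).trans_eq Nat.cast_one) ?_
  exact hs.sum_le_tsum _ fun _ _ => measureReal_nonneg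

end

/-! ### Logarithmic regret bound -/

section
variable {M : ℕ} {P : Model M} (init : ℕ → unitInterval) {π : Policy M} {b : Fin M}

/-- Nonnegativity of the losses allows dropping the restriction to the first `K` episodes. -/
lemma stepLoss_le_sum (hb : P.mean b < 1) (hq : 0 < P.quit false false)
    (hloss : ∀ s a, 0 ≤ loss P b s a) (K t : ℕ) :
    stepLoss P init π b K t ≤ ∑ a ∈ Finset.univ.erase b,
      (loss P b true a * (law P init π).real {x | (x t).state = true ∧ (x t).arm = a} +
        loss P b false a * (law P init π).real {x | (x t).state = false ∧ (x t).arm = a}) := by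
  classical
  have h1 : ∀ (s : Bool) (a : Fin M),
      loss P b s a * (law P init π).real {x | (x t).state = s ∧ (x t).arm = a} =
      ∫ x, (if (x t).state = s ∧ (x t).arm = a then loss P b s a else 0) ∂(law P init π) := by
    intro s a
    have := integral_indicator_const (μ := law P init π) (loss P b s a)
      (measurableSet_hist_step t fun _ y => y.state = s ∧ y.arm = a)
    rw [smul_eq_mul, mul_comm] at this
    rw [← this]
    refine integral_congr_ae (Eventually.of_forall fun x => ?_)
    simp [Set.indicator_apply]
  have hi : ∀ (s : Bool) (a : Fin M), Integrable (fun x : ℕ → Step M =>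
      if (x t).state = s ∧ (x t).arm = a then loss P b s a else 0) (law P init π) := fun s a =>
    integrable_hist_step P init π t fun _ y =>
      if y.state = s ∧ y.arm = a then loss P b s a else 0
  have hi2 : ∀ a : Fin M, Integrable (fun x : ℕ → Step M =>
      (if (x t).state = true ∧ (x t).arm = a then loss P b true a else 0) +
      if (x t).state = false ∧ (x t).arm = a then loss P b false a else 0) (law P init π) :=
    fun a => (hi true a).add (hi false a)
  simp only [h1]
  simp only [← integral_add (hi true _) (hi false _)]
  rw [← integral_finsetSum _ fun a _ => hi2 a, stepLoss]
  refine integral_mono (integrable_hist_step P init π t fun h y =>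
    if completed h < K then loss P b y.state y.arm else 0)
    (integrable_finsetSum _ fun a _ => hi2 a) fun x => ?_
  dsimp only
  have hnn : ∀ a, 0 ≤ (if (x t).state = true ∧ (x t).arm = a then loss P b true a else 0) +
      (if (x t).state = false ∧ (x t).arm = a then loss P b false a else 0) := fun a =>
    add_nonneg (by split_ifs; exacts [hloss _ _, le_rfl])
      (by split_ifs; exacts [hloss _ _, le_rfl])
  by_cases hxb : (x t).arm = b
  · have h0 : loss P b (x t).state (x t).arm = 0 := by rw [hxb, loss_self hb hq]
    rw [h0, ite_self]
    exact Finset.sum_nonneg fun a _ => hnn a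
  · refine le_trans ?_ (Finset.single_le_sum (f := fun a =>
      (if (x t).state = true ∧ (x t).arm = a then loss P b true a else 0) +
      (if (x t).state = false ∧ (x t).arm = a then loss P b false a else 0)) (fun a _ => hnn a)
      (Finset.mem_erase.2 ⟨hxb, Finset.mem_univ (x t).arm⟩))
    refine le_trans (b := loss P b (x t).state (x t).arm) ?_ (le_of_eq ?_)
    · split_ifs
      · exact le_rfl
      · exact hloss _ _
    · cases (x t).state <;> simp

/-- Logarithmic regret bound with slack `ε`. -/
lemma exists_regret_le (hm : ∀ a, P.mean a ≤ P.mean b) (hb : P.mean b < 1)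
    (hq : 0 < P.quit false false) (hloss : ∀ s a, 0 ≤ loss P b s a)
    (hπ : IsULCB (-1) 1 4 π) {c : ℝ} (hc0 : 0 < c) (hc1 : c ≤ 1)
    (hc : ∀ s a, c ≤ P.mean a * (1 - P.quit s true)) :
    ∃ N : ℕ, 0 < N ∧ ∀ ε : ℝ, 0 < ε →
      (∀ a, a ≠ b → P.mean a + 3 * ε ≤ (P.mean b : ℝ)) → ∃ C : ℝ, ∀ K : ℕ,
        regret P init b π K ≤ (∑ a ∈ Finset.univ.erase b,
          loss P b true a / (2 * ((P.mean b : ℝ) - P.mean a - 2 * ε) ^ 2)) * level (N * K) +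
            C := by
  obtain ⟨ρ, hρ0, hρ1, htail⟩ := exists_completed_tail hm hb hq
  -- This `N` makes `ρ ^ (N * K)` absorb the factor `4 ^ K`, so the losses after time `N * K` have a
  -- bounded sum. It does not depend on `ε`.
  obtain ⟨N, hN⟩ := exists_pow_lt_of_lt_one (show (0 : ℝ) < 1 / 4 by norm_num) hρ1
  have hN0 : 0 < N := by
    rcases Nat.eq_zero_or_pos N with rfl | h
    · norm_num at hN
    · exact h
  obtain ⟨B, hB0, hB⟩ := exists_abs_loss_le (P := P) (b := b)
  refine ⟨N, hN0, fun ε hε hgap => ?_⟩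
  have hT : ∀ a, a ≠ b → ∃ C : ℝ, ∀ n : ℕ, ∑ t ∈ Finset.range n,
      (law P init π).real {x | (x t).state = true ∧ (x t).arm = a} ≤
        level n / (2 * ((P.mean b : ℝ) - P.mean a - 2 * ε) ^ 2) + C := fun a ha =>
    exists_sum_law_true_le P init hπ a b hε (by linarith [hgap a ha])
  have hF : ∀ a, a ≠ b → ∃ C : ℝ, ∀ n : ℕ, ∑ t ∈ Finset.range n,
      (law P init π).real {x | (x t).state = false ∧ (x t).arm = a} ≤ C := fun a ha =>
    exists_sum_law_false_le P init hπ b hc0 hc1 hc hε hgap a ha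
  choose! CT hCT using hT
  choose! CF hCF using hF
  refine ⟨∑ a ∈ Finset.univ.erase b, (loss P b true a * CT a + loss P b false a * CF a) +
    B * (2 * (1 - ρ)⁻¹), fun K => ?_⟩
  have hs := summable_stepLoss init π hm hb hq K
  rw [regret_eq init π hm hb hq, ← hs.sum_add_tsum_nat_add (N * K), add_comm (∑ a ∈ _, _) (B * _),
    ← add_assoc, add_right_comm]
  refine add_le_add ?_ ?_
  · refine (Finset.sum_le_sum fun t _ => stepLoss_le_sum init hb hq hloss K t).trans ?_
    rw [Finset.sum_comm, Finset.sum_mul, ← Finset.sum_add_distrib]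
    refine Finset.sum_le_sum fun a ha => ?_
    have hab := (Finset.mem_erase.1 ha).1
    rw [Finset.sum_add_distrib, ← Finset.mul_sum, ← Finset.mul_sum]
    have h1 := mul_le_mul_of_nonneg_left (hCT a hab (N * K)) (hloss true a)
    have h2 := mul_le_mul_of_nonneg_left (hCF a hab (N * K)) (hloss false a)
    refine (add_le_add h1 h2).trans_eq ?_
    ring
  · have hg := summable_geometric_of_lt_one hρ0.le hρ1
    have h1 : ∀ t, stepLoss P init π b K (t + N * K) ≤ B * (2 * ρ ^ t) := by
      intro t
      refine (le_abs_self _).trans ((abs_stepLoss_le init π hB K _).trans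
        (mul_le_mul_of_nonneg_left ((htail init π _ K).trans ?_) hB0))
      have h2 : ρ ^ (N * K) * 4 ^ K ≤ 1 := by
        rw [pow_mul, ← mul_pow]
        exact pow_le_one₀ (by positivity) (by linarith)
      calc 2 * ρ ^ (t + N * K) * 4 ^ K = 2 * ρ ^ t * (ρ ^ (N * K) * 4 ^ K) := by
            rw [pow_add]; ring
        _ ≤ 2 * ρ ^ t := mul_le_of_le_one_right (by positivity) h2
    have h2 := ((summable_nat_add_iff (N * K)).2 hs).tsum_le_tsum h1 ((hg.mul_left 2).mul_left B)
    rwa [tsum_mul_left, tsum_mul_left, tsum_geometric_of_lt_one hρ0.le hρ1] at h2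

end

end MABA

/-! ### Passage to the limit -/

open MABA in
theorem theorem1 {m : ℕ} (P : Model (m + 2)) (init : ℕ → unitInterval) (π : Policy (m + 2))
    (hquit : ∀ i j i' j' : Bool, i.toNat + j.toNat < i'.toNat + j'.toNat →
      P.quit i' j' ≤ P.quit i j)
    (hquit00 : 0 < P.quit false false)
    (hmean : Antitone P.mean)
    (hmean1 : P.mean 0 < 1)
    (hbest : P.mean 1 < P.mean 0)
    (hlast : 0 < P.mean (Fin.last (m + 1)))
    (hquit01 : P.quit false true < 1)
    (hquit11 : P.quit true true < 1)
    (hgap : ∀ a, a ≠ 0 → gap P 0 true a ≤ gap P 0 false a)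
    (hπ : IsULCB (-1) 1 4 π) :
    (∀ s, valueV P 0 s ≠ ∞ ∧ ∀ a, valueQ P 0 s a ≠ ∞) ∧
    (∀ K, expReward P init (always 0) K ≠ ∞ ∧ expReward P init π K ≠ ∞) ∧
    limsup (fun K : ℕ => ((regret P init 0 π K / Real.log K : ℝ) : EReal)) atTop ≤
      ((∑ a ∈ Finset.univ.erase 0,
        gap P 0 true a / (2 * ((P.mean 0 : ℝ) - (P.mean a : ℝ)) ^ 2) : ℝ) : EReal) := by
  have hm : ∀ a, P.mean a ≤ P.mean 0 := fun a => hmean (Fin.zero_le a)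
  refine ⟨fun s => ⟨?_, fun a => ?_⟩, fun K => ⟨?_, ?_⟩, ?_⟩
  · rw [valueV_eq hm hmean1 hquit00]; exact ENNReal.ofReal_ne_top
  · rw [valueQ_eq hm hmean1 hquit00]; exact ENNReal.ofReal_ne_top
  · rw [expReward_eq _ _ hm hmean1 hquit00]; exact ENNReal.ofReal_ne_top
  · rw [expReward_eq _ _ hm hmean1 hquit00]; exact ENNReal.ofReal_ne_top
  simp only [gap_eq hm hmean1 hquit00] at hgap ⊢
  have hl1 := loss_true_nonneg hm hmean1 hquit00 hquit
  have hloss : ∀ s a, 0 ≤ loss P 0 s a := by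
    intro s a
    by_cases ha : a = 0
    · rw [ha, loss_self hmean1 hquit00]
    · cases s
      · exact (hl1 a).trans (hgap a ha)
      · exact hl1 a
  have h01 : (P.quit false true : ℝ) < 1 := hquit01
  have h11 : (P.quit true true : ℝ) < 1 := hquit11
  have hlast' : (0 : ℝ) < P.mean (Fin.last (m + 1)) := hlast
  have hbest' : (P.mean 1 : ℝ) < P.mean 0 := hbest
  obtain ⟨w, hw0, hw1, hw⟩ : ∃ w : ℝ, 0 < w ∧ w ≤ 1 ∧ ∀ s, w ≤ 1 - P.quit s true :=
    ⟨min (1 - P.quit false true) (1 - P.quit true true), lt_min (by linarith) (by linarith),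
      (min_le_left _ _).trans (by linarith [(P.quit false true).2.1]), fun s => by
        cases s
        exacts [min_le_left _ _, min_le_right _ _]⟩
  obtain ⟨N, hN, hreg⟩ := exists_regret_le init hm hmean1 hquit00 hloss hπ
    (c := P.mean (Fin.last (m + 1)) * w) (mul_pos hlast' hw0)
    (mul_le_one₀ (P.mean _).2.2 hw0.le hw1)
    fun s a => mul_le_mul (hmean (Fin.le_last a)) (hw s) hw0.le (P.mean a).2.1
  have hle1 : ∀ a : Fin (m + 2), a ≠ 0 → (P.mean a : ℝ) ≤ P.mean 1 := fun a ha =>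
    hmean (Fin.one_le_of_ne_zero ha)
  set S : ℝ → ℝ := fun ε => ∑ a ∈ Finset.univ.erase 0,
    loss P 0 true a / (2 * ((P.mean 0 : ℝ) - P.mean a - 2 * ε) ^ 2) with hS
  have hcont : ContinuousAt S 0 := by
    refine tendsto_finsetSum _ fun a ha => ?_
    have := hle1 a (Finset.mem_erase.1 ha).1
    refine ContinuousAt.div continuousAt_const (by fun_prop) ?_
    have : (P.mean 0 : ℝ) - P.mean a - 2 * 0 ≠ 0 := by
      have : 0 < (P.mean 0 : ℝ) - P.mean a - 2 * 0 := by linarith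
      exact this.ne'
    exact mul_ne_zero two_ne_zero (pow_ne_zero 2 this)
  have hlim : Tendsto (fun ε => ((S ε : ℝ) : EReal)) (nhdsWithin 0 (Set.Ioi 0))
      (nhds ((S 0 : ℝ) : EReal)) :=
    (continuous_coe_real_ereal.tendsto _).comp (hcont.tendsto.mono_left nhdsWithin_le_nhds)
  have hS0 : S 0 = ∑ a ∈ Finset.univ.erase 0,
      loss P 0 true a / (2 * ((P.mean 0 : ℝ) - P.mean a) ^ 2) := by simp [hS]
  rw [← hS0]
  -- It suffices to bound the limsup by `S ε` for all small `ε > 0`; `3 * ε` must stay below the gap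
  -- to the second-best arm.
  refine ge_of_tendsto hlim ?_
  have hpos : (0 : ℝ) < (P.mean 0 - P.mean 1) / 3 := by linarith
  filter_upwards [self_mem_nhdsWithin, nhdsWithin_le_nhds (gt_mem_nhds hpos)] with ε hε hε1
  obtain ⟨C, hC⟩ := hreg ε hε fun a ha => by linarith [hle1 a ha]
  have hlog : Tendsto (fun K : ℕ => Real.log (K : ℝ)) atTop atTop :=
    Real.tendsto_log_atTop.comp tendsto_natCast_atTop_atTop
  have ht : Tendsto (fun K : ℕ => S ε * (level (N * K) / Real.log K) + C / Real.log K) atTop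
      (nhds (S ε)) := by
    have := ((tendsto_level_mul_div_log hN).const_mul (S ε)).add (hlog.const_div_atTop C)
    rwa [mul_one, add_zero] at this
  have ht' : Tendsto (fun K : ℕ =>
      ((S ε * (level (N * K) / Real.log K) + C / Real.log K : ℝ) : EReal)) atTop
      (nhds ((S ε : ℝ) : EReal)) := (continuous_coe_real_ereal.tendsto _).comp ht
  rw [← ht'.limsup_eq]
  refine limsup_le_limsup ?_
  filter_upwards [eventually_ge_atTop 3] with K hK
  have hl := one_lt_log_natCast hK
  refine EReal.coe_le_coe_iff.2 ?_
  rw [← mul_div_assoc, ← add_div]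
  exact div_le_div_of_nonneg_right (hC K) (by linarith)
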